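/- **Proposition 3.1 (Difference Fay identity).** Let $t=(t_1,t_2,\dots)$ be real time variables and $n\in\mathbb Z$. All functions of $(n,t)$ below are real or complex valued, defined for $n\in\mathbb Z$ and $t\in U$, and smooth in any finite number of the variables $t_i$; here $U\subseteq\mathbb R^{\{1,2,\dots\}}$ is a set whose slices in finitely many of the variables are open. Put $\Gamma g(n)=g(n+1)$, $\Delta=\Gamma-1$, $\Delta^*=\Gamma^{-1}-1$. Pseudo-difference operators $\sum_{i\ll\infty}a_i(n,t)\Delta^i$ are composed by the Leibniz rule $\Delta^k\circ g=\sum_{i\ge0}\binom ki(\Delta^ig)(n+k-i)\,\Delta^{k-i}$; for $A=\sum_i a_i\Delta^i$ put $A_{\le0}=\sum_{i\le 0}a_i\Delta^i$ and $A^*=\sum_i(\Delta^*)^i\circ a_i$. Let $Z=z_0+z_1\Delta^{-1}+z_2\Delta^{-2}+\cdots$ be an invertible dressing operator of the discrete modified KP hierarchy, that is, with $L=Z\Delta Z^{-1}$, $$\frac{\partial Z}{\partial t_i}=-(L^i)_{\le0}\,Z\qquad(i=1,2,3,\dots).$$ With $\xi(t,\lambda)=\sum_{i\ge1}t_i\lambda^i$,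 let $$w(n,t,\lambda)=Z(n)\big((1+\lambda)^ne^{\xi(t,\lambda)}\big),\qquad w^*(n,t,\lambda)=\big(Z^{-1}(n-1)\Delta^{-1}\big)^*\big((1+\lambda)^{-n}e^{-\xi(t,\lambda)}\big)$$ be the formal wave function and adjoint wave function, where $\Delta^i$ multiplies $(1+\lambda)^ne^{\xi}$ by $\lambda^i$ and $(\Delta^*)^i$ multiplies $(1+\lambda)^{-n}e^{-\xi}$ by $\lambda^i$. Let $\tau_0,\tau_1$ be tau functions of this solution, that is, functions without zeros such that $$w(n,t,\lambda)=\frac{\tau_0(n,t-[\lambda^{-1}])}{\tau_1(n,t)}(1+\lambda)^ne^{\xi(t,\lambda)},\qquad w^*(n,t,\lambda)=\frac{\tau_1(n,t+[\lambda^{-1}])}{\tau_0(n,t)}\lambda^{-1}(1+\lambda)^{-n}e^{-\xi(t,\lambda)},$$ where $[s]=(s,s^2/2,s^3/3,\dots)$ and $f(n,t\pm[s])$ denotes the formal Taylor series in $s$. Then, as identities of formal Laurent series in $s$, $$\Delta\frac{\tau_0(n,t-[s])}{\tau_1(n,t)}=s^{-1}\left(\frac{\tau_0(n+1,t)\,\tau_1(n,t-[s])}{\tau_1(n,t)\,\tau_1(n+1,t)}-\frac{\tau_0(n+1,t-[s])}{\tau_1(n+1,t)}\right)$$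 and $$\Delta\frac{\tau_1(n,t+[s])}{\tau_0(n,t)}=s^{-1}\left(\frac{\tau_1(n,t+[s])}{\tau_0(n,t)}-\frac{\tau_0(n+1,t+[s])\,\tau_1(n,t)}{\tau_0(n,t)\,\tau_0(n+1,t)}\right).$$ -/

import Mathlib

open scoped ContDiff

namespace DmKP

/-! ### Functions of the discrete variable `n` and of the times `t = (t₁, t₂, …)` -/

/-- Time sequences `t = (t₁, t₂, t₃, …)` of real numbers. -/
abbrev Times : Type := ℕ+ → ℝ

/-- Move the finitely many coordinates `i ∈ S` of `t` by `x i`. -/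
def move (S : Finset ℕ+) (t : Times) (x : S → ℝ) : Times :=
  fun i => t i + if h : i ∈ S then x ⟨i, h⟩ else 0

/-- A set of times is an admissible domain if its slices in finitely many of the variables are
open. The whole space is one; so is `{t | ∑ |tᵢ| rⁱ < ∞}`, on which `∑ tᵢ pⁱ` makes sense
for `|p| ≤ r`. -/
def IsTimeDomain (U : Set Times) : Prop :=
  ∀ t ∈ U, ∀ S : Finset ℕ+, IsOpen {x : S → ℝ | move S t x ∈ U}

/-- Functions `f(n, t)` of `n ∈ ℤ` and `t ∈ U`, with the pointwise operations. -/
abbrev Fn (U : Set Times) (𝕂 : Type*) := ℤ → U → 𝕂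

section

variable {U : Set Times} {𝕂 : Type*}

/-- Extension of a function on `U` by `0`. It is used only to differentiate, at points of `U` and
in directions in which `U` is open, so that the values outside `U` do not matter. -/
noncomputable def zeroExt [Zero 𝕂] (f : U → 𝕂) : Times → 𝕂 :=
  Function.extend Subtype.val f 0

/-- `f(n, ·)` is a `C^∞` function of every finite set of the time variables. -/
def IsSmooth [RCLike 𝕂] (f : Fn U 𝕂) : Prop :=
  ∀ (n : ℤ) (t : U) (S : Finset ℕ+),
    ContDiffAt ℝ ∞ (fun x : S → ℝ => zeroExt (f n) (move S t x)) 0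

/-- The partial derivative `∂f/∂tᵢ`. -/
noncomputable def pderiv [RCLike 𝕂] (i : ℕ+) (f : Fn U 𝕂) : Fn U 𝕂 :=
  fun n t => deriv (fun x : ℝ => zeroExt (f n) (Function.update (t : Times) i x)) ((t : Times) i)

/-- The power `Γ^m` of the shift operator: `(Γ^m f)(n) = f(n + m)`. -/
def shift [CommRing 𝕂] (m : ℤ) : Fn U 𝕂 →+* Fn U 𝕂 where
  toFun f := fun n => f (n + m)
  map_one' := rfl
  map_mul' _ _ := rfl
  map_zero' := rfl
  map_add' _ _ := rfl

/-- The difference operator `Δ = Γ - 1`. -/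
def diff [CommRing 𝕂] (f : Fn U 𝕂) : Fn U 𝕂 := shift 1 f - f

/-- The adjoint difference operator `Δ* = Γ⁻¹ - 1`. -/
def adjDiff [CommRing 𝕂] (f : Fn U 𝕂) : Fn U 𝕂 := shift (-1) f - f

end

/-! ### Pseudo-difference operators -/

/-- A pseudo-difference operator `∑_{i ≪ ∞} aᵢ Δ^i`, given by its coefficients. -/
@[ext]
structure PDO (U : Set Times) (𝕂 : Type*) [RCLike 𝕂] where
  coeff : ℤ → Fn U 𝕂
  bdd : ∃ m : ℤ, ∀ i, m < i → coeff i = 0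

namespace PDO

variable {U : Set Times} {𝕂 : Type*} [RCLike 𝕂]

/-- The operator `Δ^m`. -/
def delta (m : ℤ) : PDO U 𝕂 where
  coeff i := if i = m then 1 else 0
  bdd := ⟨m, fun _ hi => if_neg (ne_of_gt hi)⟩

instance : One (PDO U 𝕂) := ⟨delta 0⟩

/-- The coefficient of `Δ^k` in the composition of `∑ aᵢ Δ^i` and `∑ bⱼ Δ^j` that is
determined by the Leibniz rule `Δ^i ∘ g = ∑_{l ≥ 0} (i choose l) (Δ^l g)(n + i - l) Δ^{i - l}`.
The sum over the pairs `(i, l)`, with `j = k - i + l`, has only finitely many nonzero terms. -/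
noncomputable def compCoeff (P Q : PDO U 𝕂) (k : ℤ) : Fn U 𝕂 :=
  ∑ᶠ p : ℤ × ℕ, P.coeff p.1 *
    Ring.choose p.1 p.2 • shift (p.1 - p.2) (diff^[p.2] (Q.coeff (k - p.1 + p.2)))

theorem diff_iterate_zero (l : ℕ) : diff^[l] (0 : Fn U 𝕂) = 0 := by
  induction l with
  | zero => rfl
  | succ l ih => rw [Function.iterate_succ_apply', ih]; simp [diff]

/-- Composition of pseudo-difference operators. -/
noncomputable instance : Mul (PDO U 𝕂) where
  mul P Q :=
    { coeff := compCoeff P Q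
      bdd := by
        obtain ⟨a, ha⟩ := P.bdd
        obtain ⟨b, hb⟩ := Q.bdd
        refine ⟨a + b, fun k hk => ?_⟩
        refine (finsum_congr fun p => ?_).trans finsum_zero
        by_cases h : a < p.1
        · rw [ha _ h, zero_mul]
        · rw [hb (k - p.1 + p.2) (by omega), diff_iterate_zero, map_zero, smul_zero, mul_zero] }

/-- Powers of an operator. -/
noncomputable def npow (P : PDO U 𝕂) : ℕ → PDO U 𝕂
  | 0 => 1
  | i + 1 => npow P i * P

/-- The part `(A)_{≤ 0} = ∑_{i ≤ 0} aᵢ Δ^i` of `A = ∑ aᵢ Δ^i`. -/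
def lowPart (P : PDO U 𝕂) : PDO U 𝕂 where
  coeff i := if i ≤ 0 then P.coeff i else 0
  bdd := ⟨0, fun _ hi => if_neg (not_le.mpr hi)⟩

/-- The operator whose coefficients are those of `A`, taken at `n + m` instead of `n`. -/
def shiftCoeff (m : ℤ) (P : PDO U 𝕂) : PDO U 𝕂 where
  coeff i := shift m (P.coeff i)
  bdd := by
    obtain ⟨a, ha⟩ := P.bdd
    exact ⟨a, fun i hi => by rw [ha i hi, map_zero]⟩

/-- All coefficients are smooth. -/
def Smooth (P : PDO U 𝕂) : Prop := ∀ i, IsSmooth (P.coeff i)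

end PDO

/-! ### The discrete modified KP hierarchy and its wave functions -/

section

variable {U : Set Times} {𝕂 : Type*} [RCLike 𝕂]

/-- The Lax operator `L = Z Δ Z⁻¹`, where `Y = Z⁻¹`. -/
noncomputable def laxOp (Z Y : PDO U 𝕂) : PDO U 𝕂 := Z * PDO.delta 1 * Y

/-- `Z = z₀ + z₁ Δ⁻¹ + z₂ Δ⁻² + …` is a dressing operator of the discrete modified KP hierarchy,
with inverse `Y = Z⁻¹`: it satisfies the Sato equations `∂Z/∂tᵢ = -(L^i)_{≤ 0} Z`, `i = 1, 2, …`,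
where `L = Z Δ Z⁻¹`. -/
structure IsDressing (Z Y : PDO U 𝕂) : Prop where
  order : ∀ k : ℤ, 0 < k → Z.coeff k = 0
  smooth : Z.Smooth
  smooth_inv : Y.Smooth
  mul_inv : Z * Y = 1
  inv_mul : Y * Z = 1
  sato : ∀ (i : ℕ+) (k : ℤ),
    pderiv i (Z.coeff k) = -((((laxOp Z Y).npow i).lowPart * Z).coeff k)

/-- The formal wave function `w = Z ((1 + λ)^n e^{ξ(t, λ)})`. As `Δ` multiplies
`(1 + λ)^n e^{ξ(t, λ)}` by `λ`, it is `(∑ aₖ λ^k) (1 + λ)^n e^{ξ(t, λ)}` if `Z = ∑ aₖ Δ^k`.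
The function below gives the coefficient of `λ^k` in front of `(1 + λ)^n e^{ξ(t, λ)}`. -/
def wave (Z : PDO U 𝕂) (k : ℤ) : Fn U 𝕂 := Z.coeff k

/-- The formal adjoint of `Q = ∑ q_b Δ^b` is `Q* = ∑ (Δ*)^b ∘ q_b`, where
`(Δ*)^b ∘ g = ∑_{l ≥ 0} (b choose l) ((Δ*)^l g)(n - b + l) (Δ*)^{b - l}`, and `Δ*` multiplies
`(1 + λ)^{-n} e^{-ξ(t, λ)}` by `λ`. The function below gives the coefficient of `λ^k` in front of
`(1 + λ)^{-n} e^{-ξ(t, λ)}` in `Q* ((1 + λ)^{-n} e^{-ξ(t, λ)})`; here `b = k + l`. -/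
noncomputable def adjointSymbol (Q : PDO U 𝕂) (k : ℤ) : Fn U 𝕂 :=
  ∑ᶠ l : ℕ, Ring.choose (k + l) l • shift (-k) (adjDiff^[l] (Q.coeff (k + l)))

/-- The formal adjoint wave function
`w* = (Z⁻¹(n - 1) Δ⁻¹)* ((1 + λ)^{-n} e^{-ξ(t, λ)})`, where `Y = Z⁻¹`: the coefficient of `λ^k`
in front of `(1 + λ)^{-n} e^{-ξ(t, λ)}`. -/
noncomputable def adjWave (Y : PDO U 𝕂) (k : ℤ) : Fn U 𝕂 :=
  adjointSymbol (Y.shiftCoeff (-1) * PDO.delta (-1)) k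

/-! ### Tau functions -/

/-- `f(n, t + ε[s])`, where `[s] = (s, s²/2, s³/3, …)`, as a formal power series in `s`.
The coefficient of `s^k` is the `k`-th Taylor coefficient at `s = 0`; to it only the shifts
`ε s^i/i` of the variables `tᵢ` with `i ≤ k` contribute, and the other variables are left alone. -/
noncomputable def miwa (ε : ℝ) (f : Fn U 𝕂) : PowerSeries (Fn U 𝕂) :=
  PowerSeries.mk fun k => fun n t =>
    ((k.factorial : ℝ)⁻¹) • iteratedDeriv k
      (fun s : ℝ => zeroExt (f n)
        (fun i : ℕ+ => (t : Times) i + if (i : ℕ) ≤ k then ε * (s ^ (i : ℕ) / (i : ℕ)) else 0)) 0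

/-- The coefficient of `λ^k` in `F(λ⁻¹)`, for a formal power series `F`. -/
noncomputable def coeffLambda (F : PowerSeries (Fn U 𝕂)) (k : ℤ) : Fn U 𝕂 :=
  if k ≤ 0 then PowerSeries.coeff (-k).toNat F else 0

/-- `τ₀, τ₁` are tau functions of the solution with dressing operator `Z` and `Y = Z⁻¹`:
smooth functions without zeros with
`w(n, t, λ) = τ₀(n, t - [λ⁻¹]) / τ₁(n, t) · (1 + λ)^n e^{ξ(t, λ)}` and
`w*(n, t, λ) = τ₁(n, t + [λ⁻¹]) / τ₀(n, t) · λ⁻¹ (1 + λ)^{-n} e^{-ξ(t, λ)}`. -/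
structure IsTauPair (Z Y : PDO U 𝕂) (τ₀ τ₁ : Fn U 𝕂) : Prop where
  smooth₀ : IsSmooth τ₀
  smooth₁ : IsSmooth τ₁
  ne_zero₀ : ∀ n t, τ₀ n t ≠ 0
  ne_zero₁ : ∀ n t, τ₁ n t ≠ 0
  wave_eq : ∀ k : ℤ, wave Z k = coeffLambda (miwa (-1) τ₀ * PowerSeries.C τ₁⁻¹) k
  adjWave_eq : ∀ k : ℤ,
    adjWave Y k = coeffLambda (miwa 1 τ₁ * PowerSeries.C τ₀⁻¹) (k + 1)

/-- `Δ` acting on the coefficients of a power series in `s`. -/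
noncomputable def diffSeries (F : PowerSeries (Fn U 𝕂)) : PowerSeries (Fn U 𝕂) :=
  PowerSeries.map (shift 1) F - F

/-- A formal power series in `s`, regarded as a formal Laurent series. -/
noncomputable def toLaurent (F : PowerSeries (Fn U 𝕂)) : LaurentSeries (Fn U 𝕂) :=
  HahnSeries.ofPowerSeries ℤ (Fn U 𝕂) F

/-- The formal Laurent series `s⁻¹`. -/
noncomputable def sInv : LaurentSeries (Fn U 𝕂) := HahnSeries.single (-1) 1

end

end DmKP

/-! Since $L^iZ=Z\Delta^i$, the Sato equations say $\partial w/\partial t_i=(L^i)_{>0}w$: each time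
derivative of the wave function is a finite difference operator without term of order 0, applied to
$w$ (`exists_linear_problem`). The shift $t\mapsto t-[s]$ is a flow with $s$-derivative
$-\sum_{i\ge0}s^i\partial_{i+1}$, so every positive $s$-coefficient of $w(t-[s])$ lies in the span
of $\Delta w,\Delta^2w,\dots$ (`coeff_miwaSymbol_mem`).

On the other hand $e^{\xi(t-[s],\lambda)}=(1-s\lambda)e^{\xi(t,\lambda)}$, so relative to
$(1+\lambda)^ne^{\xi}$ these coefficients have order at most 1 in $\lambda$. As $z_0=\tau_0/\tau_1$
is a unit, comparison of leading terms leaves only multiples of $\Delta w$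
(`exists_eq_smul_hatDiff`). Hence $w(t-[s])=w+s\,c(s)\Delta w$. The coefficient of $\lambda^1$ gives
$c(s)=-z_0(n,t-[s])/z_0(n+1,t)$, and at $\lambda=s^{-1}$ the factor $1-s\lambda$ kills the left side
(`flow_dressing`). Inserting the tau functions yields
$\tau_0(n+1,t)\tau_1(n,t-[s])=(1+s)\tau_1(n,t)\tau_0(n+1,t-[s])-s\,\tau_1(n+1,t)\tau_0(n,t-[s])$
(`flow_fay`). Division gives the first identity; the substitution $t\mapsto t+[s]$ followed by
division gives the second (`flow_fay_adjoint`).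

Two foundations carry this: the Taylor coefficients in `miwa` agree with a formal flow of commuting
derivations (`miwa_eq_map_flow`), and composition of pseudo-difference operators is associative
(`mul_assoc'`), which gives $L^iZ=Z\Delta^i$. -/

namespace DmKP

/-! ### Formal flows of a sequence of derivations -/

section Flow

variable {R : Type*} [CommRing R]

/-- The power series `∑ i, X ^ i * H i`. -/
noncomputable def shiftSum (H : ℕ → PowerSeries R) : PowerSeries R :=
  PowerSeries.mk fun k => ∑ i ∈ Finset.range (k + 1), PowerSeries.coeff (k - i) (H i)

theorem coeff_shiftSum (H : ℕ → PowerSeries R) (k : ℕ) :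
    PowerSeries.coeff k (shiftSum H) =
      ∑ i ∈ Finset.range (k + 1), PowerSeries.coeff (k - i) (H i) :=
  PowerSeries.coeff_mk _ _

theorem coeff_shiftSum_eq (H : ℕ → PowerSeries R) {k N : ℕ} (h : k < N) :
    PowerSeries.coeff k (shiftSum H) =
      PowerSeries.coeff k (∑ i ∈ Finset.range N, PowerSeries.X ^ i * H i) := by
  rw [coeff_shiftSum, map_sum]
  refine (Finset.sum_congr rfl fun i hi => ?_).trans
    (Finset.sum_subset (Finset.range_subset_range.2 h) fun i _ hi => ?_)
  · rw [PowerSeries.coeff_X_pow_mul', if_pos (by simpa [Nat.lt_succ_iff] using hi)]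
  · rw [PowerSeries.coeff_X_pow_mul', if_neg (by simpa [Nat.lt_succ_iff] using hi)]

theorem shiftSum_mul (H : ℕ → PowerSeries R) (G : PowerSeries R) :
    shiftSum H * G = shiftSum fun i => H i * G := by
  ext k
  rw [coeff_shiftSum_eq _ (Nat.lt_succ_self k), PowerSeries.coeff_mul]
  simp_rw [← mul_assoc]
  rw [← Finset.sum_mul, PowerSeries.coeff_mul]
  refine Finset.sum_congr rfl fun p hp => ?_
  rw [coeff_shiftSum_eq _ (k := p.1) (N := k.succ)
    (by have := Finset.HasAntidiagonal.mem_antidiagonal.1 hp; omega)]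

theorem shiftSum_add (H G : ℕ → PowerSeries R) :
    shiftSum (fun i => H i + G i) = shiftSum H + shiftSum G := by
  ext k
  simp [coeff_shiftSum, Finset.sum_add_distrib]

theorem coeff_shiftSum_congr {H G : ℕ → PowerSeries R} {k : ℕ}
    (h : ∀ i, ∀ j ≤ k, PowerSeries.coeff j (H i) = PowerSeries.coeff j (G i)) :
    PowerSeries.coeff k (shiftSum H) = PowerSeries.coeff k (shiftSum G) := by
  rw [coeff_shiftSum, coeff_shiftSum]
  exact Finset.sum_congr rfl fun i _ => h i _ (Nat.sub_le _ _)

theorem shiftSum_comm (H : ℕ → ℕ → PowerSeries R) :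
    (shiftSum fun i => shiftSum fun j => H i j) = shiftSum fun j => shiftSum fun i => H i j := by
  ext k
  simp only [coeff_shiftSum]
  rw [Finset.sum_comm' (t' := Finset.range (k + 1)) (s' := fun j => Finset.range (k - j + 1))
    (by intro i j; simp only [Finset.mem_range]; omega)]
  refine Finset.sum_congr rfl fun j _ => Finset.sum_congr rfl fun i _ => ?_
  rw [Nat.sub_right_comm]

theorem derivative_shiftSum (H : ℕ → PowerSeries R) :
    PowerSeries.derivative R (shiftSum H) =
      (shiftSum fun i => ((i + 1 : ℕ) : ℕ) • H (i + 1)) +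
        shiftSum fun i => PowerSeries.derivative R (H i) := by
  ext k
  rw [PowerSeries.coeff_derivative, map_add, coeff_shiftSum, coeff_shiftSum, coeff_shiftSum,
    Finset.sum_mul]
  have h : ∀ i ∈ Finset.range (k + 1 + 1),
      PowerSeries.coeff (k + 1 - i) (H i) * ((k : R) + 1) =
        i • PowerSeries.coeff (k + 1 - i) (H i) +
          (k + 1 - i : ℕ) • PowerSeries.coeff (k + 1 - i) (H i) := by
    intro i hi
    rw [← add_smul, nsmul_eq_mul, mul_comm]
    congr 1
    rw [Nat.add_sub_cancel' (by simpa [Nat.lt_succ_iff] using hi)]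
    push_cast
    rfl
  rw [Finset.sum_congr rfl h, Finset.sum_add_distrib]
  congr 1
  · rw [Finset.sum_range_succ', zero_smul, add_zero]
    refine Finset.sum_congr rfl fun i _ => ?_
    rw [map_nsmul, Nat.add_sub_add_right]
  · rw [Finset.sum_range_succ, Nat.sub_self, zero_smul, add_zero]
    refine Finset.sum_congr rfl fun i hi => ?_
    have : k + 1 - i = k - i + 1 := by
      have := Finset.mem_range.1 hi
      omega
    rw [PowerSeries.coeff_derivative, this, nsmul_eq_mul, mul_comm]
    push_cast
    rfl

theorem shiftSum_telescope (H : ℕ → PowerSeries R) :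
    (shiftSum fun i => H i - PowerSeries.X * H (i + 1)) = H 0 := by
  ext k
  simp only [coeff_shiftSum, map_sub, Finset.sum_sub_distrib]
  rw [Finset.sum_range_succ', Finset.sum_range_succ _ k]
  have h : ∀ i ∈ Finset.range k, PowerSeries.coeff (k - i) (PowerSeries.X * H (i + 1)) =
      PowerSeries.coeff (k - (i + 1)) (H (i + 1)) := by
    intro i hi
    have := Finset.mem_range.1 hi
    rw [show k - i = k - (i + 1) + 1 by omega, PowerSeries.coeff_succ_X_mul]
  rw [Finset.sum_congr rfl h]
  simp

/-! ### The formal substitution $t\mapsto t+\varepsilon[s]$. -/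

variable [Algebra ℝ R]

/-- The `k`-th Taylor coefficient of `f(t + ε[s])`, where `D i` stands for `∂/∂t_{i+1}`. -/
noncomputable def flowCoeff (D : ℕ → Derivation ℝ R R) (ε : ℝ) : ℕ → R → R
  | 0, f => f
  | k + 1, f => ((k + 1 : ℝ)⁻¹ * ε) • ∑ i : Fin (k + 1), flowCoeff D ε (k - i) (D i f)
  termination_by k => k
  decreasing_by omega

/-- The formal power series `f(t + ε[s])` in `s`. -/
noncomputable def flow (D : ℕ → Derivation ℝ R R) (ε : ℝ) (f : R) : PowerSeries R :=
  PowerSeries.mk fun k => flowCoeff D ε k f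

variable (D : ℕ → Derivation ℝ R R) (ε : ℝ)

theorem coeff_zero_flow (f : R) : PowerSeries.coeff 0 (flow D ε f) = f := by
  rw [flow, PowerSeries.coeff_mk, flowCoeff]

theorem coeff_succ_flow (f : R) (k : ℕ) :
    PowerSeries.coeff (k + 1) (flow D ε f) = ((k + 1 : ℝ)⁻¹ * ε) •
      PowerSeries.coeff k (shiftSum fun i => flow D ε (D i f)) := by
  rw [flow, PowerSeries.coeff_mk, flowCoeff, coeff_shiftSum, Finset.sum_range]
  simp [flow]

/-- The chain rule: $s^{i+1}/(i+1)$ has derivative $s^i$. With the constant term, this differential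
equation determines the flow. -/
theorem derivative_flow (f : R) :
    PowerSeries.derivative R (flow D ε f) = ε • shiftSum fun i => flow D ε (D i f) := by
  ext k
  rw [PowerSeries.coeff_derivative, coeff_succ_flow, PowerSeries.coeff_smul, mul_comm]
  have : ((k : R) + 1) = algebraMap ℝ R (k + 1) := by simp
  rw [this, ← Algebra.smul_def, smul_smul, ← mul_assoc, mul_inv_cancel₀ (by positivity), one_mul]

/-- A power series over an `ℝ`-algebra is determined by its constant term and derivative. -/
theorem coeff_succ_eq_of_derivative {F G : PowerSeries R} {k : ℕ}
    (h : PowerSeries.coeff k (PowerSeries.derivative R F) =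
      PowerSeries.coeff k (PowerSeries.derivative R G)) :
    PowerSeries.coeff (k + 1) F = PowerSeries.coeff (k + 1) G := by
  rw [PowerSeries.coeff_derivative, PowerSeries.coeff_derivative] at h
  have hu : ((k : R) + 1) = algebraMap ℝ R (k + 1) := by simp
  have hv : algebraMap ℝ R (k + 1) * algebraMap ℝ R (k + 1 : ℝ)⁻¹ = 1 := by
    rw [← map_mul, mul_inv_cancel₀ (by positivity), map_one]
  rw [hu] at h
  calc _ = PowerSeries.coeff (k + 1) F * algebraMap ℝ R (k + 1) *
        algebraMap ℝ R (k + 1 : ℝ)⁻¹ := by rw [mul_assoc, hv, mul_one]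
    _ = _ := by rw [h, mul_assoc, hv, mul_one]

theorem flow_add (f g : R) : flow D ε (f + g) = flow D ε f + flow D ε g := by
  ext k
  induction k using Nat.strong_induction_on generalizing f g with
  | _ k ih =>
    cases k with
    | zero => simp only [map_add, coeff_zero_flow]
    | succ k =>
      rw [map_add, coeff_succ_flow, coeff_succ_flow, coeff_succ_flow, ← smul_add, ← map_add,
        ← shiftSum_add]
      congr 1
      refine coeff_shiftSum_congr fun i j hj => ?_
      rw [map_add]
      exact ih j (by omega) _ _

/-- Both sides have the same constant term and, by the Leibniz rule for each `D i`, the same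
differential equation, which fixes coefficient `k + 1` from those up to `k`. -/
theorem flow_mul (f g : R) : flow D ε (f * g) = flow D ε f * flow D ε g := by
  ext k
  induction k using Nat.strong_induction_on generalizing f g with
  | _ k ih =>
    cases k with
    | zero => simp [PowerSeries.coeff_mul, coeff_zero_flow]
    | succ k =>
      refine coeff_succ_eq_of_derivative ?_
      rw [Derivation.leibniz, derivative_flow, derivative_flow, derivative_flow, smul_eq_mul,
        smul_eq_mul, mul_smul_comm, mul_smul_comm, ← smul_add, mul_comm (flow D ε f), shiftSum_mul,
        mul_comm (flow D ε g), shiftSum_mul, ← shiftSum_add, PowerSeries.coeff_smul,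
        PowerSeries.coeff_smul]
      congr 1
      refine coeff_shiftSum_congr fun i j hj => ?_
      rw [Derivation.leibniz, smul_eq_mul, smul_eq_mul, flow_add, map_add, map_add,
        ih j (by omega), ih j (by omega), mul_comm (flow D ε g)]
      congr 2
      exact mul_comm _ _

theorem flow_one : flow D ε 1 = 1 := by
  ext k
  cases k with
  | zero => simp [coeff_zero_flow]
  | succ k =>
    have h0 : flow D ε 0 = 0 := by simpa using flow_add D ε 0 0
    rw [coeff_succ_flow]
    simp [coeff_shiftSum, h0, PowerSeries.coeff_one]

/-- `f ↦ f(t + ε[s])` as a ring homomorphism. -/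
noncomputable def flowHom : R →+* PowerSeries R where
  toFun := flow D ε
  map_one' := flow_one D ε
  map_mul' := flow_mul D ε
  map_zero' := by simpa using flow_add D ε 0 0
  map_add' := flow_add D ε

theorem flowHom_apply (f : R) : flowHom D ε f = flow D ε f := rfl

theorem map_flow (σ : R →ₐ[ℝ] R) (hσ : ∀ i f, D i (σ f) = σ (D i f)) (f : R) :
    PowerSeries.map (σ : R →+* R) (flow D ε f) = flow D ε (σ f) := by
  ext k
  induction k using Nat.strong_induction_on generalizing f with
  | _ k ih =>
    cases k with
    | zero => simp [coeff_zero_flow]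
    | succ k =>
      rw [coeff_succ_flow, PowerSeries.coeff_map, coeff_succ_flow, RingHom.coe_coe, map_smul]
      congr 1
      rw [coeff_shiftSum, coeff_shiftSum, map_sum]
      refine Finset.sum_congr rfl fun i _ => ?_
      have := ih (k - i) (by omega) (D i f)
      rwa [PowerSeries.coeff_map, ← hσ] at this

/-- The substitution `t ↦ t + ε[s]` in the coefficients of a power series in `s`. -/
noncomputable def flowSeries (F : PowerSeries R) : PowerSeries R :=
  shiftSum fun i => flow D ε (PowerSeries.coeff i F)

theorem flowSeries_add (F G : PowerSeries R) :
    flowSeries D ε (F + G) = flowSeries D ε F + flowSeries D ε G := by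
  simp only [flowSeries, map_add, flow_add, shiftSum_add]

theorem flowSeries_X_mul (F : PowerSeries R) :
    flowSeries D ε (PowerSeries.X * F) = PowerSeries.X * flowSeries D ε F := by
  ext k
  have h0 : flow D ε 0 = 0 := map_zero (flowHom D ε)
  cases k with
  | zero => simp [flowSeries, coeff_shiftSum, h0]
  | succ k =>
    rw [PowerSeries.coeff_succ_X_mul, flowSeries, flowSeries, coeff_shiftSum, coeff_shiftSum,
      Finset.sum_range_succ']
    simp [h0, PowerSeries.coeff_succ_X_mul]

theorem flowSeries_C_mul (f : R) (F : PowerSeries R) :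
    flowSeries D ε (PowerSeries.C f * F) = flow D ε f * flowSeries D ε F := by
  rw [flowSeries, flowSeries, mul_comm (flow D ε f), shiftSum_mul]
  congr 1
  ext1 i
  rw [PowerSeries.coeff_C_mul, flow_mul, mul_comm]

theorem flowSeries_shiftSum (G : ℕ → PowerSeries R) :
    flowSeries D ε (shiftSum G) = shiftSum fun i => flowSeries D ε (G i) := by
  have hX : ∀ (i : ℕ) (F : PowerSeries R), flowSeries D ε (PowerSeries.X ^ i * F) =
      PowerSeries.X ^ i * flowSeries D ε F := by
    intro i F
    induction i with
    | zero => simp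
    | succ i ih => rw [pow_succ', mul_assoc, mul_assoc, flowSeries_X_mul, ih]
  let φ : PowerSeries R →+ PowerSeries R := AddMonoidHom.mk' _ (flowSeries_add D ε)
  ext k
  have h : PowerSeries.coeff k (flowSeries D ε (shiftSum G)) =
      PowerSeries.coeff k (φ (∑ i ∈ Finset.range (k + 1), PowerSeries.X ^ i * G i)) := by
    change _ = PowerSeries.coeff k (flowSeries D ε _)
    rw [flowSeries, flowSeries, coeff_shiftSum, coeff_shiftSum]
    refine Finset.sum_congr rfl fun i hi => ?_
    rw [coeff_shiftSum_eq G (Finset.mem_range.1 hi)]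
  rw [h, coeff_shiftSum_eq _ (Nat.lt_succ_self k), map_sum]
  congr 1
  exact Finset.sum_congr rfl fun i _ => hX i _

theorem flow_smul (c : ℝ) (f : R) : flow D ε (c • f) = c • flow D ε f := by
  ext k
  induction k using Nat.strong_induction_on generalizing f with
  | _ k ih =>
    cases k with
    | zero => simp only [PowerSeries.coeff_smul, coeff_zero_flow]
    | succ k =>
      rw [PowerSeries.coeff_smul, coeff_succ_flow, coeff_succ_flow, smul_comm c]
      congr 1
      rw [coeff_shiftSum, coeff_shiftSum, Finset.smul_sum]
      refine Finset.sum_congr rfl fun i _ => ?_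
      rw [Derivation.map_smul, ih _ (by omega), PowerSeries.coeff_smul]

theorem derivation_coeff_flow (hD : ∀ i j f, D i (D j f) = D j (D i f)) (i k : ℕ) (f : R) :
    D i (PowerSeries.coeff k (flow D ε f)) = PowerSeries.coeff k (flow D ε (D i f)) := by
  induction k using Nat.strong_induction_on generalizing f with
  | _ k ih =>
    cases k with
    | zero => simp only [coeff_zero_flow]
    | succ k =>
      rw [coeff_succ_flow, coeff_succ_flow, Derivation.map_smul]
      congr 1
      rw [coeff_shiftSum, coeff_shiftSum, map_sum]
      refine Finset.sum_congr rfl fun j _ => ?_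
      rw [ih _ (by omega), hD]

/-- The shifts by $-\varepsilon[s]$ and $\varepsilon[s]$ cancel because the composite has zero
derivative in $s$: differentiating the explicit powers of $s$ gives $-\varepsilon$ times a sum,
differentiating the shifted coefficients gives $+\varepsilon$ times the same sum. The two sums agree
because the derivations commute with the flow. -/
theorem flowSeries_flow (hD : ∀ i j f, D i (D j f) = D j (D i f)) (f : R) :
    flowSeries D ε (flow D (-ε) f) = PowerSeries.C f := by
  have hd : PowerSeries.derivative R (flowSeries D ε (flow D (-ε) f)) = 0 := by
    rw [flowSeries, derivative_shiftSum]
    have h1 : (shiftSum fun q => (q + 1) • flow D ε (PowerSeries.coeff (q + 1) (flow D (-ε) f))) =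
        (-ε) • flowSeries D ε (shiftSum fun i => flow D (-ε) (D i f)) := by
      ext k
      rw [flowSeries, PowerSeries.coeff_smul, coeff_shiftSum, coeff_shiftSum, Finset.smul_sum]
      refine Finset.sum_congr rfl fun q _ => ?_
      rw [coeff_succ_flow, flow_smul, map_nsmul, PowerSeries.coeff_smul, mul_comm, mul_smul,
        ← Nat.cast_smul_eq_nsmul ℝ, smul_comm (-ε), smul_smul, Nat.cast_succ,
        mul_inv_cancel₀ (by positivity), one_smul]
    have h2 : (shiftSum fun q => PowerSeries.derivative R
        (flow D ε (PowerSeries.coeff q (flow D (-ε) f)))) =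
        ε • shiftSum fun i => flowSeries D ε (flow D (-ε) (D i f)) := by
      simp only [derivative_flow, flowSeries, derivation_coeff_flow D _ hD]
      rw [shiftSum_comm]
      ext k
      rw [PowerSeries.coeff_smul, coeff_shiftSum, coeff_shiftSum, Finset.smul_sum]
      exact Finset.sum_congr rfl fun q _ => PowerSeries.coeff_smul _ _ _
    rw [h1, h2, flowSeries_shiftSum, neg_smul, neg_add_cancel]
  ext k
  cases k with
  | zero => simp [flowSeries, coeff_shiftSum, coeff_zero_flow]
  | succ k =>
    refine coeff_succ_eq_of_derivative ?_
    rw [hd]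
    simp

end Flow
/-! ### The difference operator on symbols -/

section Symbols

variable {A B : Type*} [CommRing A] [CommRing B]

/-- The action of `Δ` on `∑ F k λ^k (1 + λ)^n`: the operator `λ Γ + Δ` on coefficients. -/
def hatDiff (σ : A →+* A) : Module.End ℤ (ℤ → A) :=
  (AddMonoidHom.mk' (fun F k => σ (F (k - 1)) + (σ (F k) - F k)) (by
    intro F G
    ext k
    simp only [Pi.add_apply, map_add]
    ring)).toIntLinearMap

theorem hatDiff_apply (σ : A →+* A) (F : ℤ → A) (k : ℤ) :
    hatDiff σ F k = σ (F (k - 1)) + (σ (F k) - F k) := rfl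

theorem hatDiff_pow_succ_apply (σ : A →+* A) (j : ℕ) (F : ℤ → A) :
    (hatDiff σ ^ (j + 1)) F = hatDiff σ ((hatDiff σ ^ j) F) := by
  rw [pow_succ', Module.End.mul_apply]

/-- Stated for additive maps so that it serves flows, extraction of a coefficient in $s$,
multiplication by a shift-invariant element, and the inclusion of smooth functions alike. -/
theorem hatDiff_pow_comp (σ : A →+* A) (ρ : B →+* B) (φ : A →+ B) (h : ∀ a, φ (σ a) = ρ (φ a))
    (j : ℕ) (F : ℤ → A) (k : ℤ) :
    φ ((hatDiff σ ^ j) F k) = (hatDiff ρ ^ j) (fun k => φ (F k)) k := by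
  induction j generalizing k with
  | zero => rfl
  | succ j ih =>
    rw [hatDiff_pow_succ_apply, hatDiff_pow_succ_apply, hatDiff_apply, hatDiff_apply, map_add,
      map_sub, h, h, ih, ih]

theorem hatDiff_pow_shift (σ : A →+* A) (j : ℕ) (F : ℤ → A) (m k : ℤ) :
    (hatDiff σ ^ j) (fun k => F (k - m)) k = (hatDiff σ ^ j) F (k - m) := by
  induction j generalizing k with
  | zero => rfl
  | succ j ih =>
    rw [hatDiff_pow_succ_apply, hatDiff_pow_succ_apply, hatDiff_apply, hatDiff_apply, ih, ih,
      sub_right_comm]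

theorem hatDiff_pow_mul (σ : A →+* A) (a : A) (ha : σ a = a) (j : ℕ) (F : ℤ → A) (k : ℤ) :
    (hatDiff σ ^ j) (fun k => a * F k) k = a * (hatDiff σ ^ j) F k :=
  (hatDiff_pow_comp σ σ (AddMonoidHom.mulLeft a) (fun b => by simp [ha]) j F k).symm

theorem hatDiff_smul (σ : A →+* A) (a : A) (F : ℤ → A) :
    hatDiff σ (a • F) = σ a • hatDiff σ F + (σ a - a) • F := by
  ext k
  simp only [hatDiff_apply, Pi.smul_apply, Pi.add_apply, smul_eq_mul, map_mul]
  ring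

theorem hatDiff_pow_eq_zero (σ : A →+* A) {F : ℤ → A} {m : ℤ} (hF : ∀ k, m < k → F k = 0) (j : ℕ)
    {k : ℤ} (hk : m + j < k) : (hatDiff σ ^ j) F k = 0 := by
  induction j generalizing k with
  | zero => exact hF _ (by simpa using hk)
  | succ j ih =>
    push_cast at hk
    rw [hatDiff_pow_succ_apply, hatDiff_apply, ih (by omega), ih (by omega)]
    simp

/-- Only the summand $\lambda\Gamma$ raises the order, so the leading coefficient is merely shifted.
-/
theorem hatDiff_pow_top (σ : A →+* A) {F : ℤ → A} {m : ℤ} (hF : ∀ k, m < k → F k = 0) (j : ℕ) :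
    (hatDiff σ ^ j) F (m + j) = σ^[j] (F m) := by
  induction j with
  | zero => simp
  | succ j ih =>
    rw [hatDiff_pow_succ_apply, hatDiff_apply,
      hatDiff_pow_eq_zero σ hF j (k := m + ↑(j + 1)) (by push_cast; omega)]
    push_cast
    rw [← add_assoc, add_sub_cancel_right, ih, map_zero, sub_zero, add_zero,
      Function.iterate_succ_apply']

/-- The symbols `P F`, where `P` is a difference operator without term of order `0`. -/
def positiveSpan (σ : A →+* A) (F : ℤ → A) : Submodule A (ℤ → A) :=
  Submodule.span A (Set.range fun j : ℕ => (hatDiff σ ^ (j + 1)) F)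

theorem hatDiff_pow_mem (σ : A →+* A) (F : ℤ → A) (j : ℕ) :
    (hatDiff σ ^ (j + 1)) F ∈ positiveSpan σ F :=
  Submodule.subset_span ⟨j, rfl⟩

theorem hatDiff_mem (σ : A →+* A) (F : ℤ → A) {X : ℤ → A} (hX : X ∈ positiveSpan σ F) :
    hatDiff σ X ∈ positiveSpan σ F := by
  induction hX using Submodule.span_induction with
  | mem x hx =>
    obtain ⟨j, rfl⟩ := hx
    change hatDiff σ ((hatDiff σ ^ (j + 1)) F) ∈ _
    rw [← hatDiff_pow_succ_apply]
    exact hatDiff_pow_mem σ F _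
  | zero => rw [map_zero]; exact zero_mem _
  | add x y _ _ hx hy => rw [map_add]; exact add_mem hx hy
  | smul a x hx' hx =>
    rw [hatDiff_smul]
    exact add_mem (Submodule.smul_mem _ _ hx) (Submodule.smul_mem _ _ hx')

theorem hatDiff_pow_mem_of_mem (σ : A →+* A) (F : ℤ → A) {X : ℤ → A} (hX : X ∈ positiveSpan σ F)
    (j : ℕ) : (hatDiff σ ^ j) X ∈ positiveSpan σ F := by
  induction j with
  | zero => exact hX
  | succ j ih => rw [hatDiff_pow_succ_apply]; exact hatDiff_mem σ F ih

/-- A difference operator without term of order `0` whose product with an operator of order `0`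
has order at most `1` is of the form `c Δ`. -/
theorem exists_eq_smul_hatDiff (σ : A →+* A) {F : ℤ → A} (hF : ∀ k, 0 < k → F k = 0)
    (hreg : ∀ j, IsRegular (σ^[j] (F 0))) {X : ℤ → A} (hX : X ∈ positiveSpan σ F)
    (hX1 : ∀ k, 1 < k → X k = 0) : ∃ c : A, X = c • hatDiff σ F := by
  have key : ∀ (J : ℕ) (c : ℕ → A),
      (∀ k, 1 < k → (∑ j ∈ Finset.range (J + 1), c j • (hatDiff σ ^ (j + 1)) F) k = 0) →
      ∑ j ∈ Finset.range (J + 1), c j • (hatDiff σ ^ (j + 1)) F = c 0 • hatDiff σ F := by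
    intro J c
    induction J with
    | zero => intro _; simp
    | succ J ih =>
      intro h
      -- Summand `j` has order at most `j + 1`, so at order `J + 2` only the last one contributes:
      -- `c (J + 1)` times a regular element. Thus the top term drops out.
      have hJ := h ((J + 1 + 1 : ℕ) : ℤ) (by push_cast; omega)
      have hlow : ∑ j ∈ Finset.range (J + 1), c j * (hatDiff σ ^ (j + 1)) F ((J + 1 + 1 : ℕ) : ℤ)
          = 0 := by
        refine Finset.sum_eq_zero fun j hj => ?_
        have := Finset.mem_range.1 hj
        rw [hatDiff_pow_eq_zero σ hF _ (by push_cast; omega), mul_zero]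
      have htop := hatDiff_pow_top σ hF (J + 1 + 1)
      rw [zero_add] at htop
      simp only [Finset.sum_apply, Pi.smul_apply, smul_eq_mul] at hJ
      rw [Finset.sum_range_succ, hlow, zero_add, htop] at hJ
      have hc : c (J + 1) = 0 := (hreg _).right.mul_right_eq_zero_iff.1 hJ
      rw [Finset.sum_range_succ, hc, zero_smul, add_zero] at h ⊢
      exact ih h
  obtain ⟨c, rfl⟩ := Finsupp.mem_span_range_iff_exists_finsupp.1 hX
  obtain ⟨J, hJ⟩ := c.support.exists_nat_subset_range
  have hs : (c.sum fun j a => a • (hatDiff σ ^ (j + 1)) F) =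
      ∑ j ∈ Finset.range (J + 1), c j • (hatDiff σ ^ (j + 1)) F :=
    Finsupp.sum_of_support_subset _
      (hJ.trans (Finset.range_subset_range.2 (Nat.le_succ J))) _ (by simp)
  rw [hs] at hX1 ⊢
  exact ⟨c 0, key J c hX1⟩

end Symbols

/-! ### The wave function at the shifted times $t-[s]$. -/

section Dressing

variable {R : Type*} [CommRing R] [Algebra ℝ R] (D : ℕ → Derivation ℝ R R) (σ : R →ₐ[ℝ] R)

/-- The symbol of `Z(t - [s]) (1 - s Δ)`, if `F` is the symbol of `Z`. -/
noncomputable def miwaSymbol (F : ℤ → R) (k : ℤ) : PowerSeries R :=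
  flow D (-1) (F k) - PowerSeries.X * flow D (-1) (F (k - 1))

variable {D σ}

/-- The exponential contributes $\lambda^{i+1}$ to $\partial_{i+1}w$, so `E i` is the symbol of this
derivative and the claim is the chain rule for $w(t-[s])$. It is consistent with the factor
$1-s\lambda$ because $\sum_i s^i\lambda^{i+1}(1-s\lambda)$ telescopes to $\lambda$. -/
theorem derivative_miwaSymbol {F : ℤ → R} {E : ℕ → ℤ → R}
    (hE : ∀ (i : ℕ) k, D i (F k) + F (k - (i + 1)) = E i k) (k : ℤ) :
    PowerSeries.derivative R (miwaSymbol D F k) = -shiftSum fun i => miwaSymbol D (E i) k := by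
  have hS : (fun i => miwaSymbol D (E i) k) = fun i : ℕ =>
      (flow D (-1) (D i (F k)) + (-PowerSeries.X) * flow D (-1) (D i (F (k - 1)))) +
        (flow D (-1) (F (k - 1 - (i : ℕ))) -
          PowerSeries.X * flow D (-1) (F (k - 1 - (i + 1 : ℕ)))) := by
    ext1 i
    rw [miwaSymbol, ← hE, ← hE, flow_add, flow_add, Nat.cast_succ,
      show k - 1 - (i : ℤ) = k - (i + 1) by ring]
    ring
  have hX : (shiftSum fun i => (-PowerSeries.X) * flow D (-1) (D i (F (k - 1)))) =
      -PowerSeries.X * shiftSum fun i => flow D (-1) (D i (F (k - 1))) := by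
    rw [mul_comm (-PowerSeries.X), shiftSum_mul]
    simp only [mul_comm]
  rw [hS, shiftSum_add, shiftSum_add,
    shiftSum_telescope fun i => flow D (-1) (F (k - 1 - (i : ℕ))), hX, miwaSymbol, map_sub,
    Derivation.leibniz, derivative_flow, derivative_flow, PowerSeries.derivative_X, Nat.cast_zero,
    sub_zero]
  simp only [smul_eq_mul, neg_smul, one_smul]
  ring

theorem miwaSymbol_hatDiff_pow (hσ : ∀ i f, D i (σ f) = σ (D i f)) (F : ℤ → R) (j : ℕ) (k : ℤ) :
    miwaSymbol D ((hatDiff (σ : R →+* R) ^ j) F) k =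
      (hatDiff (PowerSeries.map (σ : R →+* R)) ^ j) (miwaSymbol D F) k := by
  have h1 : ∀ k, flow D (-1) ((hatDiff (σ : R →+* R) ^ j) F k) =
      (hatDiff (PowerSeries.map (σ : R →+* R)) ^ j) (fun k => flow D (-1) (F k)) k :=
    hatDiff_pow_comp (σ : R →+* R) (PowerSeries.map (σ : R →+* R))
      (flowHom D (-1) : R →+ PowerSeries R) (fun a => (map_flow D (-1) σ hσ a).symm) j F
  have h2 : miwaSymbol D F = (fun k => flow D (-1) (F k)) -
      fun k => PowerSeries.X * flow D (-1) (F (k - 1)) := rfl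
  rw [h2, map_sub, Pi.sub_apply, hatDiff_pow_mul _ _ (PowerSeries.map_X _),
    hatDiff_pow_shift _ _ (fun k => flow D (-1) (F k)), ← h1, ← h1, miwaSymbol]

/-- The differential equation expresses coefficient `m + 1` through powers $\Delta^{j+1}$ of the
coefficients `q ≤ m`. Coefficient 0 is `F` itself; the others lie in the span by induction, and the
span is stable under $\Delta$. -/
theorem coeff_miwaSymbol_mem (hσ : ∀ i f, D i (σ f) = σ (D i f)) {F : ℤ → R} {J : ℕ → ℕ}
    {b : ℕ → ℕ → R}
    (hF : ∀ (i : ℕ) k, D i (F k) + F (k - (i + 1)) =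
      ∑ j ∈ Finset.range (J i), b i j * (hatDiff (σ : R →+* R) ^ (j + 1)) F k) (m : ℕ) :
    (fun k => PowerSeries.coeff (m + 1) (miwaSymbol D F k)) ∈ positiveSpan (σ : R →+* R) F := by
  induction m using Nat.strong_induction_on with
  | _ m ih =>
    have hq : ∀ q ≤ m, ∀ j, (fun k => PowerSeries.coeff q
        ((hatDiff (PowerSeries.map (σ : R →+* R)) ^ (j + 1)) (miwaSymbol D F) k)) ∈
          positiveSpan (σ : R →+* R) F := by
      intro q hq j
      have h1 : (fun k => PowerSeries.coeff q
        ((hatDiff (PowerSeries.map (σ : R →+* R)) ^ (j + 1)) (miwaSymbol D F) k)) =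
          (hatDiff (σ : R →+* R) ^ (j + 1))
            (fun k => PowerSeries.coeff q (miwaSymbol D F k)) := by
        ext1 k
        exact hatDiff_pow_comp (PowerSeries.map (σ : R →+* R)) (σ : R →+* R)
          (PowerSeries.coeff q : PowerSeries R →ₗ[R] R).toAddMonoidHom
          (fun a => PowerSeries.coeff_map _ _ _) (j + 1) _ k
      rw [h1]
      cases q with
      | zero =>
        have h0 : (fun k => PowerSeries.coeff 0 (miwaSymbol D F k)) = F := by
          ext1 k
          rw [miwaSymbol, map_sub, coeff_zero_flow, PowerSeries.coeff_zero_X_mul, sub_zero]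
        rw [h0]
        exact hatDiff_pow_mem _ _ _
      | succ q => exact hatDiff_pow_mem_of_mem _ _ (ih q hq) _
    have hE : ∀ i, (miwaSymbol D fun k => ∑ j ∈ Finset.range (J i),
        b i j * (hatDiff (σ : R →+* R) ^ (j + 1)) F k) = fun k => ∑ j ∈ Finset.range (J i),
          flow D (-1) (b i j) *
            (hatDiff (PowerSeries.map (σ : R →+* R)) ^ (j + 1)) (miwaSymbol D F) k := by
      intro i
      ext1 k
      simp only [← miwaSymbol_hatDiff_pow hσ, miwaSymbol, ← flowHom_apply, map_sum, map_mul,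
        Finset.mul_sum, ← Finset.sum_sub_distrib]
      exact Finset.sum_congr rfl fun j _ => by ring
    have hd : (fun k => PowerSeries.coeff (m + 1) (miwaSymbol D F k)) =
        algebraMap ℝ R (-(m + 1 : ℝ)⁻¹) • ∑ i ∈ Finset.range (m + 1),
          ∑ j ∈ Finset.range (J i),
            ∑ p ∈ Finset.HasAntidiagonal.antidiagonal (m - i),
              PowerSeries.coeff p.1 (flow D (-1) (b i j)) • fun k => PowerSeries.coeff p.2
                ((hatDiff (PowerSeries.map (σ : R →+* R)) ^ (j + 1)) (miwaSymbol D F) k) := by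
      ext1 k
      have h1 := congrArg (PowerSeries.coeff m) (derivative_miwaSymbol hF k)
      simp only [hE] at h1
      rw [PowerSeries.coeff_derivative, map_neg, coeff_shiftSum] at h1
      simp only [Pi.smul_apply, Finset.sum_apply, smul_eq_mul]
      have h2 : algebraMap ℝ R (m + 1 : ℝ)⁻¹ * ((m : R) + 1) = 1 := by
        have : ((m : R) + 1) = algebraMap ℝ R (m + 1) := by simp
        rw [this, ← map_mul, inv_mul_cancel₀ (by positivity), map_one]
      simp only [map_sum, PowerSeries.coeff_mul] at h1
      rw [map_neg, neg_mul, ← mul_neg, ← h1, mul_left_comm, h2, mul_one]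
    rw [hd]
    refine Submodule.smul_mem _ _ (Submodule.sum_mem _ fun i _ => Submodule.sum_mem _ fun j _ =>
      Submodule.sum_mem _ fun p hp => Submodule.smul_mem _ _ (hq _ ?_ _))
    have := Finset.HasAntidiagonal.mem_antidiagonal.1 hp
    omega

/-- This is the coefficient of $s^r$ after setting $\lambda=s^{-1}$, since $s^m\lambda^{m-r}$
becomes $s^r$. The factor $1-s\lambda$ makes the sum telescope; order at most 1 in $\lambda$ bounds
`m` by `r + 1`. -/
theorem sum_coeff_miwaSymbol {F : ℤ → R} (h0 : ∀ k, 0 < k → F k = 0) (r : ℕ) :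
    ∑ m ∈ Finset.range (r + 2), PowerSeries.coeff m (miwaSymbol D F (m - r)) = 0 := by
  have hz : flow D (-1) 0 = 0 := map_zero (flowHom D (-1))
  have h : ∀ N : ℕ, ∑ m ∈ Finset.range (N + 1), PowerSeries.coeff m (miwaSymbol D F (m - r)) =
      PowerSeries.coeff N (flow D (-1) (F (N - r))) := by
    intro N
    induction N with
    | zero => simp [miwaSymbol]
    | succ N ih =>
      rw [Finset.sum_range_succ, ih, miwaSymbol, map_sub, PowerSeries.coeff_succ_X_mul,
        show ((N + 1 : ℕ) : ℤ) - r - 1 = N - r by push_cast; ring]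
      ring
  rw [h, h0 _ (by push_cast; omega), hz, map_zero]

theorem flow_dressing (hσ : ∀ i f, D i (σ f) = σ (D i f)) {F : ℤ → R} {J : ℕ → ℕ}
    {b : ℕ → ℕ → R}
    (hF : ∀ (i : ℕ) k, D i (F k) + F (k - (i + 1)) =
      ∑ j ∈ Finset.range (J i), b i j * (hatDiff (σ : R →+* R) ^ (j + 1)) F k)
    (h0 : ∀ k, 0 < k → F k = 0) (hreg : ∀ j, IsRegular (σ^[j] (F 0))) :
    PowerSeries.C (σ (F 0)) * PowerSeries.mk (fun r => F (-r)) =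
      flow D (-1) (F 0) * ((1 + PowerSeries.X) * PowerSeries.mk (fun r => σ (F (-r)))
        - PowerSeries.X * PowerSeries.mk (fun r => F (-r))) := by
  have hz : flow D (-1) 0 = 0 := map_zero (flowHom D (-1))
  have hc : ∀ m, ∃ c : R, (fun k => PowerSeries.coeff (m + 1) (miwaSymbol D F k)) =
      c • hatDiff (σ : R →+* R) F := fun m =>
    exists_eq_smul_hatDiff _ h0 hreg (coeff_miwaSymbol_mem hσ hF m) fun k hk => by
      rw [miwaSymbol, h0 _ (by omega), h0 _ (by omega), hz, mul_zero, sub_zero, map_zero]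
  choose c hc using hc
  -- The coefficient of $\lambda^1$ in $w(t-[s])=w+s\,c(s)\Delta w$.
  have hc1 : PowerSeries.C (σ (F 0)) * PowerSeries.mk c = -flow D (-1) (F 0) := by
    ext m
    have := congrFun (hc m) 1
    simp only [miwaSymbol, h0 1 one_pos, hz, map_zero, zero_sub, Pi.smul_apply,
      hatDiff_apply, sub_self, map_neg, PowerSeries.coeff_succ_X_mul, add_zero, smul_eq_mul] at this
    rw [PowerSeries.coeff_C_mul, PowerSeries.coeff_mk, map_neg, this, mul_comm]
    rfl
  have hX : ∀ f : ℤ → R, f 1 = 0 → PowerSeries.X * PowerSeries.mk (fun r => f (-r)) =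
      PowerSeries.mk fun r => f (1 - r) := by
    intro f hf
    ext r
    cases r with
    | zero => simp [hf]
    | succ r =>
      rw [PowerSeries.coeff_succ_X_mul, PowerSeries.coeff_mk, PowerSeries.coeff_mk]
      congr 1
      push_cast
      ring
  -- The same relation at $\lambda=s^{-1}$, where the left side vanishes and
  -- $s\Delta=s(\lambda\Gamma+\Gamma-1)$ becomes $(1+s)\Gamma-s$.
  have hW : PowerSeries.mk (fun r => F (-r)) + PowerSeries.mk c *
      ((1 + PowerSeries.X) * PowerSeries.mk (fun r => σ (F (-r)))
        - PowerSeries.X * PowerSeries.mk (fun r => F (-r))) = 0 := by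
    rw [add_mul, one_mul, hX _ (h0 1 one_pos),
      hX (fun k => σ (F k)) (by simp [h0 1 one_pos])]
    ext r
    have := sum_coeff_miwaSymbol (D := D) h0 r
    rw [Finset.sum_range_succ', add_comm] at this
    rw [map_add, PowerSeries.coeff_mul, Finset.Nat.sum_antidiagonal_eq_sum_range_succ_mk, map_zero,
      ← this]
    congr 1
    · rw [miwaSymbol, map_sub, coeff_zero_flow, PowerSeries.coeff_zero_X_mul, sub_zero,
        PowerSeries.coeff_mk, Nat.cast_zero, zero_sub]
    · refine Finset.sum_congr rfl fun m hm => ?_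
      have hm' := Finset.mem_range.1 hm
      have h2 := congrFun (hc m) ((m + 1 : ℕ) - r)
      rw [h2]
      simp only [map_sub, map_add, PowerSeries.coeff_mk, Pi.smul_apply, hatDiff_apply, smul_eq_mul,
        RingHom.coe_coe]
      rw [show ((m + 1 : ℕ) : ℤ) - r - 1 = -((r - m : ℕ) : ℤ) by omega,
        show ((m + 1 : ℕ) : ℤ) - r = 1 - ((r - m : ℕ) : ℤ) by omega]
      ring
  linear_combination PowerSeries.C (σ (F 0)) * hW - ((1 + PowerSeries.X) *
    PowerSeries.mk (fun r => σ (F (-r))) - PowerSeries.X * PowerSeries.mk (fun r => F (-r))) * hc1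

end Dressing
/-! ### Smooth functions of the times -/

section Smooth

open Topology Filter

variable {U : Set Times} {𝕂 : Type*} [RCLike 𝕂]

theorem zeroExt_coe (f : U → 𝕂) (t : U) : zeroExt f t = f t :=
  Subtype.val_injective.extend_apply _ _ _

theorem zeroExt_mk (f : U → 𝕂) {t : Times} (h : t ∈ U) : zeroExt f t = f ⟨t, h⟩ :=
  zeroExt_coe f ⟨t, h⟩

theorem zeroExt_of_notMem (f : U → 𝕂) {t : Times} (h : t ∉ U) : zeroExt f t = 0 := by
  rw [zeroExt, Function.extend_apply' _ _ _ (by rintro ⟨a, rfl⟩; exact h a.2)]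
  rfl

theorem zeroExt_add (f g : U → 𝕂) (t : Times) :
    zeroExt (f + g) t = zeroExt f t + zeroExt g t := by
  by_cases h : t ∈ U
  · simp only [zeroExt_mk _ h, Pi.add_apply]
  · simp only [zeroExt_of_notMem _ h, add_zero]

theorem zeroExt_mul (f g : U → 𝕂) (t : Times) :
    zeroExt (f * g) t = zeroExt f t * zeroExt g t := by
  by_cases h : t ∈ U
  · simp only [zeroExt_mk _ h, Pi.mul_apply]
  · simp only [zeroExt_of_notMem _ h, mul_zero]

theorem zeroExt_smul (c : ℝ) (f : U → 𝕂) (t : Times) :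
    zeroExt (c • f) t = c • zeroExt f t := by
  by_cases h : t ∈ U
  · simp only [zeroExt_mk _ h, Pi.smul_apply]
  · simp only [zeroExt_of_notMem _ h, smul_zero]

theorem move_zero (S : Finset ℕ+) (t : Times) : move S t 0 = t := by
  ext i
  simp [move]

theorem move_move (S : Finset ℕ+) (t : Times) (x y : S → ℝ) :
    move S (move S t x) y = move S t (x + y) := by
  ext i
  by_cases h : i ∈ S <;> simp [move, h, add_assoc]

theorem update_move (S : Finset ℕ+) (t : Times) (x : S → ℝ) (i : S) (u : ℝ) :
    Function.update (move S t x) i u = move S t (Function.update x i (u - t i)) := by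
  ext k
  by_cases hk : k = i
  · subst hk
    simp [move]
  · rw [Function.update_of_ne hk]
    simp only [move]
    congr 1
    split_ifs with h
    · rw [Function.update_of_ne (by simpa [Subtype.ext_iff] using hk)]
    · rfl

theorem IsTimeDomain.eventually_move (hU : IsTimeDomain U) {S : Finset ℕ+} {t : Times} (ht : t ∈ U)
    {x : S → ℝ} (hx : move S t x ∈ U) : ∀ᶠ y in 𝓝 x, move S t y ∈ U :=
  (hU t ht S).mem_nhds hx

theorem IsSmooth.contDiffAt {f : Fn U 𝕂} (hf : IsSmooth f) (n : ℤ) (S : Finset ℕ+) {t : Times}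
    {x : S → ℝ} (hx : move S t x ∈ U) :
    ContDiffAt ℝ ∞ (fun y : S → ℝ => zeroExt (f n) (move S t y)) x := by
  have h := hf n ⟨_, hx⟩ S
  have h2 : (fun y : S → ℝ => zeroExt (f n) (move S t y)) =
      (fun y : S → ℝ => zeroExt (f n) (move S (move S t x) y)) ∘ fun y => y - x := by
    ext y
    simp [move_move]
  rw [h2]
  refine ContDiffAt.comp x ?_ (contDiffAt_id.sub contDiffAt_const)
  rw [sub_self]
  exact h

theorem isSmooth_const (hU : IsTimeDomain U) (c : 𝕂) : IsSmooth (fun _ _ => c : Fn U 𝕂) := by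
  intro n t S
  refine (contDiffAt_const (c := c)).congr_of_eventuallyEq ?_
  filter_upwards [hU.eventually_move t.2 (x := (0 : S → ℝ)) (by rw [move_zero]; exact t.2)]
    with y hy
  rw [zeroExt_mk _ hy]

theorem IsSmooth.add {f g : Fn U 𝕂} (hf : IsSmooth f) (hg : IsSmooth g) : IsSmooth (f + g) := by
  intro n t S
  simp only [Pi.add_apply, zeroExt_add]
  exact (hf n t S).add (hg n t S)

theorem IsSmooth.mul {f g : Fn U 𝕂} (hf : IsSmooth f) (hg : IsSmooth g) : IsSmooth (f * g) := by
  intro n t S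
  simp only [Pi.mul_apply, zeroExt_mul]
  exact (hf n t S).mul (hg n t S)

theorem IsSmooth.shift {f : Fn U 𝕂} (hf : IsSmooth f) (m : ℤ) : IsSmooth (shift m f) :=
  fun n t S => hf (n + m) t S

/-- `∂f/∂tᵢ` in terms of the derivative of `f` in finitely many variables. -/
theorem IsSmooth.zeroExt_pderiv {f : Fn U 𝕂} (hf : IsSmooth f) (n : ℤ) {S : Finset ℕ+} (i : S)
    {t : Times} {x : S → ℝ} (hx : move S t x ∈ U) :
    zeroExt (pderiv i f n) (move S t x) =
      fderiv ℝ (fun y : S → ℝ => zeroExt (f n) (move S t y)) x (Pi.single i 1) := by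
  rw [zeroExt_mk _ hx, pderiv]
  simp only [update_move]
  have hd := ((hf.contDiffAt n S hx).differentiableAt (by simp)).hasFDerivAt
  have hi : (move S t x i - t i) = x i := by simp [move]
  have hg : HasDerivAt (fun u : ℝ => Function.update x i (u - t i)) (Pi.single i 1)
      (move S t x i) := by
    have h1 := hasDerivAt_update x i (move S t x i - t i)
    exact h1.comp_sub_const (move S t x i) (t i)
  have hx' : Function.update x i (move S t x i - t i) = x := by rw [hi, Function.update_eq_self]
  refine HasDerivAt.deriv ?_
  rw [← hx'] at hd
  have := hd.comp_hasDerivAt (move S t x i) hg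
  rwa [hx'] at this

/-- Lets the set of variables be enlarged, so that it contains the variable of differentiation. -/
theorem IsSmooth.mono {f : Fn U 𝕂}
    (h : ∀ (n : ℤ) (t : U) (S : Finset ℕ+), ∃ S', S ⊆ S' ∧
      ContDiffAt ℝ ∞ (fun x : S' → ℝ => zeroExt (f n) (move S' t x)) 0) : IsSmooth f := by
  intro n t S
  obtain ⟨S', hS, hf⟩ := h n t S
  let e : (S → ℝ) → S' → ℝ := fun x i => if hi : (i : ℕ+) ∈ S then x ⟨i, hi⟩ else 0
  have he : ContDiff ℝ ∞ e := by
    refine contDiff_pi.2 fun i => ?_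
    by_cases hi : (i : ℕ+) ∈ S
    · simp only [e, hi, dite_true]
      exact contDiff_apply ℝ ℝ _
    · simp only [e, hi, dite_false]
      exact contDiff_const
  have h2 : (fun x : S → ℝ => zeroExt (f n) (move S t x)) =
      (fun x : S' → ℝ => zeroExt (f n) (move S' t x)) ∘ e := by
    ext x
    simp only [Function.comp_apply]
    congr 1
    ext i
    by_cases hi : i ∈ S
    · simp [move, e, hi, hS hi]
    · simp [move, e, hi]
  rw [h2]
  refine ContDiffAt.comp 0 ?_ he.contDiffAt
  have he0 : e 0 = 0 := by
    ext i
    simp [e]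
  rw [he0]
  exact hf

theorem IsSmooth.eventually_zeroExt_pderiv (hU : IsTimeDomain U) {f : Fn U 𝕂} (hf : IsSmooth f)
    (n : ℤ) {S : Finset ℕ+} (i : S) (t : U) :
    (fun x : S → ℝ => zeroExt (pderiv i f n) (move S t x)) =ᶠ[𝓝 0] fun x =>
      fderiv ℝ (fun y : S → ℝ => zeroExt (f n) (move S t y)) x (Pi.single i 1) := by
  filter_upwards [hU.eventually_move t.2 (x := (0 : S → ℝ)) (by rw [move_zero]; exact t.2)]
    with x hx
  exact hf.zeroExt_pderiv n i hx

theorem IsSmooth.pderiv (hU : IsTimeDomain U) {f : Fn U 𝕂} (hf : IsSmooth f) (i : ℕ+) :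
    IsSmooth (pderiv i f) := by
  refine IsSmooth.mono fun n t S => ⟨insert i S, Finset.subset_insert _ _, ?_⟩
  refine ContDiffAt.congr_of_eventuallyEq ?_
    (hf.eventually_zeroExt_pderiv hU n ⟨i, Finset.mem_insert_self _ _⟩ t)
  exact ((hf n t _).fderiv_right (by simp)).clm_apply contDiffAt_const

theorem IsSmooth.pderiv_comm (hU : IsTimeDomain U) {f : Fn U 𝕂} (hf : IsSmooth f) (i j : ℕ+) :
    DmKP.pderiv i (DmKP.pderiv j f) = DmKP.pderiv j (DmKP.pderiv i f) := by
  ext n t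
  let S : Finset ℕ+ := {i, j}
  have h0 : move S (t : Times) 0 ∈ U := by rw [move_zero]; exact t.2
  have key : ∀ a b : S, DmKP.pderiv a (DmKP.pderiv b f) n t =
      fderiv ℝ (fderiv ℝ (fun y : S → ℝ => zeroExt (f n) (move S t y))) 0 (Pi.single a 1)
        (Pi.single b 1) := by
    intro a b
    have h1 : zeroExt (DmKP.pderiv a (DmKP.pderiv b f) n) (move S t 0) =
        DmKP.pderiv a (DmKP.pderiv b f) n t := by rw [move_zero, zeroExt_coe]
    rw [← h1, (hf.pderiv hU b).zeroExt_pderiv n a h0,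
      (hf.eventually_zeroExt_pderiv hU n b t).fderiv_eq, fderiv_clm_apply]
    · simp
    · exact ((hf n t S).fderiv_right (m := 1) (by norm_cast)).differentiableAt (by simp)
    · exact differentiableAt_const _
  have hi := key ⟨i, by simp [S]⟩ ⟨j, by simp [S]⟩
  have hj := key ⟨j, by simp [S]⟩ ⟨i, by simp [S]⟩
  rw [hi, hj]
  exact (hf n t S).isSymmSndFDerivAt (by
    rw [minSmoothness_of_isRCLikeNormedField]
    exact WithTop.coe_le_coe.2 (le_top : (2 : ℕ∞) ≤ ⊤)) _ _

theorem IsSmooth.differentiableAt_update {f : Fn U 𝕂} (hf : IsSmooth f) (i : ℕ+) (n : ℤ) (t : U) :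
    DifferentiableAt ℝ (fun x : ℝ => zeroExt (f n) (Function.update (t : Times) i x))
      ((t : Times) i) := by
  have h1 : ∀ x, Function.update (t : Times) i x =
      move {i} t (fun _ => x - (t : Times) i) := by
    intro x
    ext k
    by_cases hk : k = i
    · subst hk; simp [move]
    · simp [move, hk]
  simp only [h1]
  have h2 := (hf n t {i}).differentiableAt (by simp)
  have h3 : (0 : ({i} : Finset ℕ+) → ℝ) = (fun x _ => x - (t : Times) i) ((t : Times) i) := by
    ext; simp
  rw [h3] at h2
  refine h2.comp ((t : Times) i) (f := fun x (_ : ({i} : Finset ℕ+)) => x - (t : Times) i) ?_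
  exact differentiableAt_pi.2 fun _ => differentiableAt_id.sub_const _

theorem IsSmooth.hasDerivAt_curve {f : Fn U 𝕂} (hf : IsSmooth f) (n : ℤ) {S : Finset ℕ+}
    {t : Times} {c : ℝ → S → ℝ} {c' : S → ℝ} {s : ℝ} (hc : HasDerivAt c c' s)
    (hs : move S t (c s) ∈ U) :
    HasDerivAt (fun s => zeroExt (f n) (move S t (c s)))
      (∑ i : S, c' i • zeroExt (DmKP.pderiv i f n) (move S t (c s))) s := by
  have h := ((hf.contDiffAt n S hs).differentiableAt (by simp)).hasFDerivAt.comp_hasDerivAt s hc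
  refine h.congr_deriv ?_
  conv_lhs => rw [pi_eq_sum_univ' c', map_sum]
  refine Finset.sum_congr rfl fun i _ => ?_
  rw [map_smul, hf.zeroExt_pderiv n i hs]

/-- The algebra of smooth functions. -/
def smoothFn (hU : IsTimeDomain U) (𝕂 : Type*) [RCLike 𝕂] : Subalgebra ℝ (Fn U 𝕂) where
  carrier := {f | IsSmooth f}
  add_mem' := IsSmooth.add
  mul_mem' := IsSmooth.mul
  algebraMap_mem' r := isSmooth_const hU (algebraMap ℝ 𝕂 r)

/-- `∂/∂t_{i+1}` as a derivation of the algebra of smooth functions. -/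
noncomputable def smoothDeriv (hU : IsTimeDomain U) (𝕂 : Type*) [RCLike 𝕂] (i : ℕ) :
    Derivation ℝ (smoothFn hU 𝕂) (smoothFn hU 𝕂) :=
  Derivation.mk'
    { toFun := fun f => ⟨pderiv i.succPNat f.1, IsSmooth.pderiv hU f.2 _⟩
      map_add' := by
        intro f g
        ext n t
        have hf := IsSmooth.differentiableAt_update f.2 i.succPNat n t
        have hg := IsSmooth.differentiableAt_update g.2 i.succPNat n t
        change deriv (fun x => zeroExt (f.1 n + g.1 n) _) _ = _
        simp only [zeroExt_add]
        exact deriv_fun_add hf hg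
      map_smul' := by
        intro c f
        ext n t
        have hf := IsSmooth.differentiableAt_update f.2 i.succPNat n t
        change deriv (fun x => zeroExt (c • f.1 n) _) _ = _
        simp only [zeroExt_smul]
        exact deriv_fun_const_smul c hf }
    (by
      intro f g
      ext n t
      have hf := IsSmooth.differentiableAt_update f.2 i.succPNat n t
      have hg := IsSmooth.differentiableAt_update g.2 i.succPNat n t
      change deriv (fun x => zeroExt (f.1 n * g.1 n) _) _ =
        f.1 n t * pderiv i.succPNat g.1 n t + g.1 n t * pderiv i.succPNat f.1 n t
      simp only [zeroExt_mul]
      rw [deriv_fun_mul hf hg, Function.update_eq_self, zeroExt_coe, zeroExt_coe, add_comm,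
        mul_comm (g.1 n t)]
      rfl)

theorem smoothDeriv_comm (hU : IsTimeDomain U) (i j : ℕ) (f : smoothFn hU 𝕂) :
    smoothDeriv hU 𝕂 i (smoothDeriv hU 𝕂 j f) = smoothDeriv hU 𝕂 j (smoothDeriv hU 𝕂 i f) :=
  Subtype.ext (IsSmooth.pderiv_comm hU f.2 _ _)

/-- The shift `Γ` on the algebra of smooth functions. -/
def smoothShift (hU : IsTimeDomain U) (𝕂 : Type*) [RCLike 𝕂] :
    smoothFn hU 𝕂 →ₐ[ℝ] smoothFn hU 𝕂 where
  toFun f := ⟨shift 1 f.1, IsSmooth.shift f.2 1⟩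
  map_one' := rfl
  map_mul' _ _ := rfl
  map_zero' := rfl
  map_add' _ _ := rfl
  commutes' _ := rfl

theorem smoothDeriv_smoothShift (hU : IsTimeDomain U) (i : ℕ) (f : smoothFn hU 𝕂) :
    smoothDeriv hU 𝕂 i (smoothShift hU 𝕂 f) = smoothShift hU 𝕂 (smoothDeriv hU 𝕂 i f) := rfl

/-! ### Taylor coefficients along the curve $t+\varepsilon[s]$. -/

theorem iteratedDeriv_pow_smul_zero {h : ℝ → 𝕂} (hh : ContDiffAt ℝ ∞ h 0) (j k : ℕ) :
    ((k.factorial : ℝ)⁻¹) • iteratedDeriv k (fun s : ℝ => s ^ j • h s) 0 =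
      if j ≤ k then (((k - j).factorial : ℝ)⁻¹) • iteratedDeriv (k - j) h 0 else 0 := by
  have h1 := iteratedDerivWithin_smul (n := k) (f := fun s : ℝ => s ^ j) (g := h)
    (Set.mem_univ (0 : ℝ)) uniqueDiffOn_univ (by fun_prop)
    (contDiffWithinAt_univ.2 (hh.of_le (by exact_mod_cast le_top)))
  simp only [iteratedDerivWithin_univ, iteratedDeriv_fun_pow_zero] at h1
  change _ • iteratedDeriv k ((fun s : ℝ => s ^ j) • h) 0 = _
  rw [h1]
  split_ifs with hjk
  · rw [Finset.sum_eq_single j (fun i _ hi => by simp [hi])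
      (fun hj => absurd (Finset.mem_range.2 (Nat.lt_succ_of_le hjk)) hj), if_pos rfl,
      ← Nat.cast_smul_eq_nsmul ℝ, smul_smul, smul_smul]
    congr 1
    have := Nat.choose_mul_factorial_mul_factorial hjk
    have h2 : ((k.choose j : ℝ)) * j.factorial * (k - j).factorial = k.factorial := by
      exact_mod_cast this
    rw [← h2]
    have h3 : (k.choose j : ℝ) ≠ 0 := by exact_mod_cast (Nat.choose_pos hjk).ne'
    have h4 : (j.factorial : ℝ) ≠ 0 := by positivity
    have h5 : ((k - j).factorial : ℝ) ≠ 0 := by positivity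
    field_simp
  · rw [Finset.sum_eq_zero, smul_zero]
    intro i hi
    have := Finset.mem_range.1 hi
    rw [if_neg (by omega), Nat.cast_zero, zero_smul, smul_zero]

/-- The time `t + ε[s]`, where only the first `N` variables are moved. -/
noncomputable def miwaCurve (ε : ℝ) (N : ℕ) (t : Times) (s : ℝ) : Times :=
  fun i => t i + if (i : ℕ) ≤ N then ε * (s ^ (i : ℕ) / (i : ℕ)) else 0

/-- The indices of the first `N` time variables. -/
def firstTimes (N : ℕ) : Finset ℕ+ :=
  (Finset.range N).map ⟨Nat.succPNat, Nat.succPNat_injective⟩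

theorem mem_firstTimes {N : ℕ} {i : ℕ+} : i ∈ firstTimes N ↔ (i : ℕ) ≤ N := by
  simp only [firstTimes, Finset.mem_map, Finset.mem_range, Function.Embedding.coeFn_mk]
  constructor
  · rintro ⟨a, ha, rfl⟩
    simpa using ha
  · intro h
    have := i.pos
    exact ⟨i.natPred, by rw [PNat.natPred]; omega, PNat.succPNat_natPred i⟩

theorem sum_firstTimes (N : ℕ) (g : ℕ+ → 𝕂) :
    ∑ i ∈ firstTimes N, g i = ∑ j ∈ Finset.range N, g j.succPNat :=
  Finset.sum_map _ _ _

theorem miwaCurve_eq_move (ε : ℝ) (N : ℕ) (t : Times) (s : ℝ) :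
    miwaCurve ε N t s =
      move (firstTimes N) t fun i => ε * (s ^ ((i : ℕ+) : ℕ) / ((i : ℕ+) : ℕ)) := by
  ext i
  simp only [miwaCurve, move, mem_firstTimes, dite_eq_ite]

theorem miwaCurve_zero (ε : ℝ) (N : ℕ) (t : Times) : miwaCurve ε N t 0 = t := by
  ext i
  simp [miwaCurve]

theorem contDiffAt_miwaCurve {f : Fn U 𝕂} (hf : IsSmooth f) (ε : ℝ) (N : ℕ) (n : ℤ) (t : U) :
    ContDiffAt ℝ ∞ (fun s => zeroExt (f n) (miwaCurve ε N t s)) 0 := by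
  simp only [miwaCurve_eq_move]
  refine ContDiffAt.comp (0 : ℝ) (g := fun x => zeroExt (f n) (move (firstTimes N) t x))
    (f := fun s (i : firstTimes N) => ε * (s ^ ((i : ℕ+) : ℕ) / ((i : ℕ+) : ℕ))) ?_ ?_
  · refine hf.contDiffAt n _ ?_
    have := miwaCurve_eq_move ε N t 0
    rw [miwaCurve_zero] at this
    rw [← this]
    exact t.2
  · refine contDiffAt_pi.2 fun i => ?_
    fun_prop

theorem deriv_miwaCurve (hU : IsTimeDomain U) {f : Fn U 𝕂} (hf : IsSmooth f) (ε : ℝ) (N : ℕ)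
    (n : ℤ) (t : U) :
    deriv (fun s => zeroExt (f n) (miwaCurve ε N t s)) =ᶠ[𝓝 0] fun s =>
      ∑ j ∈ Finset.range N,
        ε • (s ^ j • zeroExt (pderiv j.succPNat f n) (miwaCurve ε N t s)) := by
  let c : ℝ → firstTimes N → ℝ := fun s i => ε * (s ^ ((i : ℕ+) : ℕ) / ((i : ℕ+) : ℕ))
  have hc : ∀ s, HasDerivAt c (fun i => ε * s ^ ((i : ℕ+) : ℕ).pred) s := by
    intro s
    refine hasDerivAt_pi.2 fun i => ?_
    have h1 := ((hasDerivAt_pow ((i : ℕ+) : ℕ) s).div_const (((i : ℕ+) : ℕ) : ℝ)).const_mul ε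
    have h2 : (((i : ℕ+) : ℕ) : ℝ) ≠ 0 := by exact_mod_cast (i : ℕ+).ne_zero
    rw [mul_div_cancel_left₀ _ h2] at h1
    exact h1
  have h0 : ∀ᶠ s in 𝓝 (0 : ℝ), move (firstTimes N) t (c s) ∈ U := by
    have hm : move (firstTimes N) t (c 0) ∈ U := by
      have := miwaCurve_eq_move ε N t 0
      rw [miwaCurve_zero] at this
      rw [← this]
      exact t.2
    exact (hc 0).continuousAt.eventually (hU.eventually_move t.2 hm)
  filter_upwards [h0] with s hs
  have := (hf.hasDerivAt_curve n (hc s) hs).deriv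
  simp only [miwaCurve_eq_move]
  rw [this, Finset.sum_coe_sort (firstTimes N) fun i => (ε * s ^ (i : ℕ).pred) •
    zeroExt (pderiv i f n) (move (firstTimes N) t (c s)), sum_firstTimes]
  refine Finset.sum_congr rfl fun j _ => ?_
  rw [mul_smul]
  rfl

/-- The curve in `miwa` has `N = k`, but the induction lowers `k` on a fixed curve, hence `k ≤ N`.
Variables beyond the `k`-th do not affect the `k`-th coefficient. -/
theorem iteratedDeriv_miwaCurve (hU : IsTimeDomain U) (f : smoothFn hU 𝕂) (ε : ℝ) {k N : ℕ}
    (hk : k ≤ N) (n : ℤ) (t : U) :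
    ((k.factorial : ℝ)⁻¹) • iteratedDeriv k (fun s => zeroExt (f.1 n) (miwaCurve ε N t s)) 0 =
      (PowerSeries.coeff k (flow (smoothDeriv hU 𝕂) ε f)).1 n t := by
  induction k using Nat.strong_induction_on generalizing f with
  | _ k ih =>
    cases k with
    | zero => simp [coeff_zero_flow, miwaCurve_zero, zeroExt_coe]
    | succ k =>
      have hg : ∀ j : ℕ, ContDiffAt ℝ ∞ (fun s => zeroExt (pderiv j.succPNat f.1 n)
          (miwaCurve ε N t s)) 0 := fun j =>
        contDiffAt_miwaCurve (IsSmooth.pderiv hU f.2 _) ε N n t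
      have hsum : ∀ J : Finset ℕ, iteratedDeriv k (fun s : ℝ => ∑ j ∈ J,
          ε • (s ^ j • zeroExt (pderiv j.succPNat f.1 n) (miwaCurve ε N t s))) 0 =
          ∑ j ∈ J, ε • iteratedDeriv k (fun s : ℝ =>
            s ^ j • zeroExt (pderiv j.succPNat f.1 n) (miwaCurve ε N t s)) 0 := by
        intro J
        have hj : ∀ j : ℕ, ContDiffAt ℝ k (fun s : ℝ =>
            ε • (s ^ j • zeroExt (pderiv j.succPNat f.1 n) (miwaCurve ε N t s))) 0 := fun j =>
          (ContDiffAt.smul (f := fun s : ℝ => s ^ j) (by fun_prop)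
            ((hg j).of_le (m := k) (by exact_mod_cast le_top))).const_smul ε
        induction J using Finset.induction_on with
        | empty => simp
        | insert a J ha ihJ =>
          simp only [Finset.sum_insert ha]
          rw [iteratedDeriv_fun_add (hj a) (ContDiffAt.sum fun j _ => hj j), ihJ,
            iteratedDeriv_fun_const_smul_field]
      rw [iteratedDeriv_succ', (deriv_miwaCurve hU f.2 ε N n t).iteratedDeriv_eq, hsum,
        coeff_succ_flow, coeff_shiftSum]
      have h1 : (((k + 1).factorial : ℝ))⁻¹ = (k + 1 : ℝ)⁻¹ * ((k.factorial : ℝ))⁻¹ := by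
        rw [Nat.factorial_succ]; push_cast; rw [mul_inv]
      rw [← Finset.smul_sum, h1, mul_smul, smul_comm _ ε, Finset.smul_sum]
      simp only [iteratedDeriv_pow_smul_zero (hg _)]
      rw [← Finset.sum_filter, smul_smul]
      have h2 : (Finset.range N).filter (fun j => j ≤ k) = Finset.range (k + 1) := by
        ext j
        simp only [Finset.mem_filter, Finset.mem_range]
        omega
      rw [h2]
      have h3 : ∀ j ∈ Finset.range (k + 1), (((k - j).factorial : ℝ)⁻¹) •
          iteratedDeriv (k - j) (fun s => zeroExt (pderiv j.succPNat f.1 n)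
            (miwaCurve ε N t s)) 0 = (PowerSeries.coeff (k - j)
              (flow (smoothDeriv hU 𝕂) ε (smoothDeriv hU 𝕂 j f))).1 n t := fun j _ =>
        ih (k - j) (by omega) (smoothDeriv hU 𝕂 j f) (by omega)
      rw [Finset.sum_congr rfl h3]
      simp [Finset.sum_apply]

theorem miwa_eq_map_flow (hU : IsTimeDomain U) (ε : ℝ) (f : smoothFn hU 𝕂) :
    miwa ε (f : Fn U 𝕂) = PowerSeries.map (smoothFn hU 𝕂).val.toRingHom
      (flow (smoothDeriv hU 𝕂) ε f) := by
  ext k n t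
  rw [miwa, PowerSeries.coeff_mk, PowerSeries.coeff_map]
  exact iteratedDeriv_miwaCurve hU f ε le_rfl n t

end Smooth
/-! ### Associativity of the composition of pseudo-difference operators -/

section Assoc

variable {U : Set Times} {𝕂 : Type*} [RCLike 𝕂]

theorem shift_shift (a b : ℤ) (f : Fn U 𝕂) : shift a (shift b f) = shift (a + b) f := by
  funext n
  change f (n + a + b) = f (n + (a + b))
  rw [add_assoc]

theorem shift_zero (f : Fn U 𝕂) : shift 0 f = f := by
  funext n
  change f (n + 0) = f n
  rw [add_zero]

theorem shift_injective (a : ℤ) : Function.Injective (shift a : Fn U 𝕂 →+* Fn U 𝕂) := by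
  intro f g h
  rw [← shift_zero f, ← shift_zero g, ← neg_add_cancel a, ← shift_shift, ← shift_shift, h]

theorem diff_shift (a : ℤ) (f : Fn U 𝕂) : diff (shift a f) = shift a (diff f) := by
  rw [diff, diff, map_sub, shift_shift, shift_shift, add_comm]

theorem diff_add (f g : Fn U 𝕂) : diff (f + g) = diff f + diff g := by
  simp only [diff, map_add]
  ring

theorem diff_iterate_sum {ι : Type*} (s : Finset ι) (f : ι → Fn U 𝕂) (l : ℕ) :
    diff^[l] (∑ i ∈ s, f i) = ∑ i ∈ s, diff^[l] (f i) := by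
  induction l with
  | zero => rfl
  | succ l ih =>
    simp only [Function.iterate_succ_apply', ih]
    exact map_sum (AddMonoidHom.mk' diff diff_add) _ _

/-- The action of `Δ^i`, for an integer `i`, on the symbol `∑ F k λ^k`. -/
noncomputable def powDiff (i : ℤ) (F : ℤ → Fn U 𝕂) (k : ℤ) : Fn U 𝕂 :=
  ∑ᶠ l : ℕ, Ring.choose i l • shift (i - l) (diff^[l] (F (k - i + l)))

/-- The coefficients of `F` vanish above `c`. -/
def VanishesAbove (c : ℤ) (F : ℤ → Fn U 𝕂) : Prop := ∀ k, c < k → F k = 0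

theorem powDiff_eq_sum {c : ℤ} {F : ℤ → Fn U 𝕂} (hF : VanishesAbove c F) {i k : ℤ} {N : ℕ}
    (hN : c < k - i + N) : powDiff i F k = ∑ l ∈ Finset.range N,
      Ring.choose i l • shift (i - l) (diff^[l] (F (k - i + l))) := by
  refine finsum_eq_sum_of_support_subset _ fun l hl => ?_
  by_contra h
  have h' : N ≤ l := by simpa using h
  refine hl ?_
  dsimp only
  rw [hF _ (by omega), PDO.diff_iterate_zero, map_zero, smul_zero]

theorem powDiff_vanishesAbove {c : ℤ} {F : ℤ → Fn U 𝕂} (hF : VanishesAbove c F) (i : ℤ) :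
    VanishesAbove (c + i) (powDiff i F) := by
  intro k hk
  rw [powDiff_eq_sum hF (N := 0) (by push_cast; omega), Finset.range_zero, Finset.sum_empty]

theorem powDiff_zero (F : ℤ → Fn U 𝕂) : powDiff 0 F = F := by
  funext k
  rw [powDiff, finsum_eq_single _ 0]
  · simp [shift_zero]
  · intro l hl
    obtain ⟨l, rfl⟩ := Nat.exists_eq_succ_of_ne_zero hl
    rw [Nat.succ_eq_add_one, Ring.choose_zero_succ, zero_smul]

/-- The action of `Δ` on symbols. -/
noncomputable abbrev symbolDiff (U : Set Times) (𝕂 : Type*) [RCLike 𝕂] :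
    Module.End ℤ (ℤ → Fn U 𝕂) := hatDiff (A := Fn U 𝕂) (shift 1)

theorem symbolDiff_apply (F : ℤ → Fn U 𝕂) (k : ℤ) :
    symbolDiff U 𝕂 F k = shift 1 (F (k - 1)) + diff (F k) := rfl

theorem symbolDiff_powDiff {c : ℤ} {F : ℤ → Fn U 𝕂} (hF : VanishesAbove c F) (i : ℤ) :
    symbolDiff U 𝕂 (powDiff i F) = powDiff (i + 1) F := by
  funext k
  obtain ⟨N, hN⟩ : ∃ N : ℕ, c < k - i - 1 + N := ⟨(c - k + i + 2).toNat, by omega⟩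
  -- The $\Delta$ part is cut one term earlier than the $\lambda\Gamma$ part, so that its term `l`
  -- meets term `l + 1` of the other in Pascal's rule.
  rw [symbolDiff_apply, powDiff_eq_sum hF (N := N + 1) (by push_cast; omega),
    powDiff_eq_sum hF (N := N) (by omega),
    powDiff_eq_sum hF (N := N + 1) (by push_cast; omega), map_sum]
  change _ + AddMonoidHom.mk' diff diff_add _ = _
  rw [map_sum, Finset.sum_range_succ', Finset.sum_range_succ' _ N, add_right_comm,
    ← Finset.sum_add_distrib]
  congr 1
  · refine Finset.sum_congr rfl fun l _ => ?_
    rw [Ring.choose_succ_succ, add_smul, map_zsmul, map_zsmul, add_comm]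
    change Ring.choose i l • diff (shift _ _) + _ = _
    rw [diff_shift, shift_shift, ← Function.iterate_succ_apply' diff]
    have e1 : i - (l : ℤ) = i + 1 - ((l + 1 : ℕ) : ℤ) := by push_cast; ring
    have e2 : k - i + (l : ℤ) = k - (i + 1) + ((l + 1 : ℕ) : ℤ) := by push_cast; ring
    have e3 : 1 + (i - ((l + 1 : ℕ) : ℤ)) = i + 1 - ((l + 1 : ℕ) : ℤ) := by ring
    have e4 : k - 1 - i = k - (i + 1) := by ring
    rw [e1, e2, e3, e4]
  · simp only [Ring.choose_zero_right, one_smul, Function.iterate_zero, id, Nat.cast_zero,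
      add_zero, sub_zero, shift_shift]
    rw [add_comm 1 i, show k - 1 - i = k - (i + 1) by ring]

/-- $\Delta$ is injective on symbols bounded above: coefficient `k + 1` of the image determines `X
k` from `X (k + 1)`, descending from the top. -/
theorem eq_of_symbolDiff_eq {c : ℤ} {X Y : ℤ → Fn U 𝕂} (hX : VanishesAbove c X)
    (hY : VanishesAbove c Y) (h : symbolDiff U 𝕂 X = symbolDiff U 𝕂 Y) : X = Y := by
  have key : ∀ m : ℕ, ∀ k, c - m < k → X k = Y k := by
    intro m
    induction m with
    | zero =>
      intro k hk
      rw [hX k (by simpa using hk), hY k (by simpa using hk)]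
    | succ m ih =>
      intro k hk
      push_cast at hk
      have h1 := congrFun h (k + 1)
      rw [symbolDiff_apply, symbolDiff_apply, ih (k + 1) (by omega), add_sub_cancel_right]
        at h1
      exact shift_injective 1 (add_right_cancel h1)
  funext k
  exact key (c - k + 1).toNat k (by omega)

/-- Reduces identities for $\Delta^i$, $i\in\mathbb Z$, to $i=0$ and one step: upwards $\Delta$ is
applied, downwards it is cancelled. This avoids convolution identities for binomials with negative
upper argument. -/
theorem eq_of_symbolDiff_step {c : ℤ} {X Y : ℤ → ℤ → Fn U 𝕂} (hX : ∀ i, VanishesAbove (c + i) (X i))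
    (hY : ∀ i, VanishesAbove (c + i) (Y i)) (sX : ∀ i, symbolDiff U 𝕂 (X i) = X (i + 1))
    (sY : ∀ i, symbolDiff U 𝕂 (Y i) = Y (i + 1)) (h0 : X 0 = Y 0) (i : ℤ) : X i = Y i := by
  induction i using Int.induction_on with
  | zero => exact h0
  | succ i ih => rw [← sX, ← sY, ih]
  | pred i ih =>
    refine eq_of_symbolDiff_eq (hX _) (hY _) ?_
    rw [sX, sY, sub_add_cancel, ih]

theorem powDiff_powDiff {c : ℤ} {F : ℤ → Fn U 𝕂} (hF : VanishesAbove c F) (i j : ℤ) :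
    powDiff i (powDiff j F) = powDiff (i + j) F := by
  have hj := powDiff_vanishesAbove hF j
  refine eq_of_symbolDiff_step (c := c + j) (X := fun i => powDiff i (powDiff j F))
    (Y := fun i => powDiff (i + j) F) (fun i => powDiff_vanishesAbove hj i) (fun i => ?_)
    (fun i => symbolDiff_powDiff hj i) (fun i => ?_) ?_ i
  · rw [add_assoc, add_comm j i]
    exact powDiff_vanishesAbove hF _
  · rw [symbolDiff_powDiff hF, add_right_comm]
  · simp only [powDiff_zero, zero_add]

/-- The right-hand side of the Leibniz rule for `Δ^i (g F)`. -/
noncomputable def leibnizSum (i : ℤ) (g : Fn U 𝕂) (F : ℤ → Fn U 𝕂) (k : ℤ) : Fn U 𝕂 :=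
  ∑ᶠ l : ℕ, (Ring.choose i l • shift (i - l) (diff^[l] g)) * powDiff (i - l) F k

theorem leibnizSum_eq_sum {c : ℤ} {F : ℤ → Fn U 𝕂} (hF : VanishesAbove c F) (g : Fn U 𝕂)
    {i k : ℤ} {N : ℕ} (hN : c < k - i + N) : leibnizSum i g F k = ∑ l ∈ Finset.range N,
      (Ring.choose i l • shift (i - l) (diff^[l] g)) * powDiff (i - l) F k := by
  refine finsum_eq_sum_of_support_subset _ fun l hl => ?_
  by_contra h
  have h' : N ≤ l := by simpa using h
  refine hl ?_
  dsimp only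
  rw [powDiff_vanishesAbove hF (i - l) k (by omega), mul_zero]

theorem symbolDiff_leibnizSum {c : ℤ} {F : ℤ → Fn U 𝕂} (hF : VanishesAbove c F) (g : Fn U 𝕂)
    (i : ℤ) : symbolDiff U 𝕂 (leibnizSum i g F) = leibnizSum (i + 1) g F := by
  funext k
  obtain ⟨N, hN⟩ : ∃ N : ℕ, c < k - i - 1 + N := ⟨(c - k + i + 2).toNat, by omega⟩
  have hs : ∀ a (X : ℤ → Fn U 𝕂), shift 1 (a * X (k - 1)) + diff (a * X k) =
      shift 1 a * symbolDiff U 𝕂 X k + (shift 1 a - a) * X k := by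
    intro a X
    rw [symbolDiff_apply]
    simp only [diff, map_mul]
    ring
  rw [symbolDiff_apply, leibnizSum_eq_sum hF g (N := N + 1) (by push_cast; omega),
    leibnizSum_eq_sum hF g (N := N + 1) (k := k) (by push_cast; omega),
    leibnizSum_eq_sum hF g (N := N + 1) (by push_cast; omega), map_sum]
  change _ + AddMonoidHom.mk' diff diff_add _ = _
  rw [map_sum, ← Finset.sum_add_distrib]
  simp only [AddMonoidHom.mk'_apply, hs, symbolDiff_powDiff hF]
  rw [Finset.sum_add_distrib, Finset.sum_range_succ', Finset.sum_range_succ _ N,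
    powDiff_vanishesAbove hF (i - N) k (by omega), mul_zero, add_zero,
    Finset.sum_range_succ' _ N, add_right_comm, ← Finset.sum_add_distrib]
  congr 1
  · refine Finset.sum_congr rfl fun l _ => ?_
    have e1 : i - ((l + 1 : ℕ) : ℤ) + 1 = i - l := by push_cast; ring
    have e2 : i + 1 - ((l + 1 : ℕ) : ℤ) = i - l := by push_cast; ring
    have e3 : 1 + (i - ((l + 1 : ℕ) : ℤ)) = i - l := by push_cast; ring
    rw [e1, e2, ← add_mul, map_zsmul, map_zsmul, shift_shift, e3, ← smul_sub]
    congr 1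
    rw [Ring.choose_succ_succ, add_smul, add_comm, Function.iterate_succ_apply' diff l,
      ← diff_shift]
    rfl
  · simp only [Ring.choose_zero_right, one_smul,
      Function.iterate_zero, id, Nat.cast_zero, sub_zero, shift_shift]
    rw [add_comm 1 i]

theorem powDiff_mul_left {c : ℤ} {F : ℤ → Fn U 𝕂} (hF : VanishesAbove c F) (g : Fn U 𝕂) (i : ℤ) :
    powDiff i (fun k => g * F k) = leibnizSum i g F := by
  have hg : VanishesAbove c (fun k => g * F k) := fun k hk => by
    dsimp only
    rw [hF k hk, mul_zero]
  refine eq_of_symbolDiff_step (c := c) (X := fun i => powDiff i (fun k => g * F k))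
    (Y := fun i => leibnizSum i g F) (fun i => powDiff_vanishesAbove hg i) (fun i k hk => ?_)
    (fun i => symbolDiff_powDiff hg i) (fun i => symbolDiff_leibnizSum hF g i) ?_ i
  · rw [leibnizSum_eq_sum hF g (N := 0) (by push_cast; omega), Finset.range_zero,
      Finset.sum_empty]
  · rw [powDiff_zero]
    funext k
    rw [leibnizSum, finsum_eq_single _ 0]
    · simp [shift_zero, powDiff_zero]
    · intro l hl
      obtain ⟨l, rfl⟩ := Nat.exists_eq_succ_of_ne_zero hl
      rw [Nat.succ_eq_add_one, Ring.choose_zero_succ, zero_smul, zero_mul]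

theorem powDiff_natCast {c : ℤ} {F : ℤ → Fn U 𝕂} (hF : VanishesAbove c F) (j : ℕ) :
    powDiff j F = (symbolDiff U 𝕂 ^ j) F := by
  induction j with
  | zero => exact powDiff_zero F
  | succ j ih => rw [hatDiff_pow_succ_apply, ← ih, symbolDiff_powDiff hF, Nat.cast_succ]

/-! ### Operators acting on symbols, and associativity. -/

namespace PDO

/-- The action of a pseudo-difference operator on a symbol. -/
noncomputable def act (P : PDO U 𝕂) (F : ℤ → Fn U 𝕂) (k : ℤ) : Fn U 𝕂 :=
  ∑ᶠ i, P.coeff i * powDiff i F k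

theorem act_eq_sum {a c : ℤ} {P : PDO U 𝕂} (hP : VanishesAbove a P.coeff) {F : ℤ → Fn U 𝕂}
    (hF : VanishesAbove c F) {k m : ℤ} (hm : m ≤ k - c) :
    P.act F k = ∑ i ∈ Finset.Icc m a, P.coeff i * powDiff i F k := by
  refine finsum_eq_sum_of_support_subset _ fun i hi => ?_
  rw [Finset.mem_coe, Finset.mem_Icc]
  by_contra h
  rw [not_and_or, not_le, not_le] at h
  refine hi ?_
  dsimp only
  rcases h with h | h
  · rw [powDiff_vanishesAbove hF i k (by omega), mul_zero]
  · rw [hP _ h, zero_mul]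

theorem act_vanishesAbove {a c : ℤ} {P : PDO U 𝕂} (hP : VanishesAbove a P.coeff)
    {F : ℤ → Fn U 𝕂} (hF : VanishesAbove c F) : VanishesAbove (a + c) (P.act F) := by
  intro k hk
  rw [act_eq_sum hP hF le_rfl, Finset.Icc_eq_empty (by omega), Finset.sum_empty]

theorem compCoeff_eq_sum {a b : ℤ} {P Q : PDO U 𝕂} (hP : VanishesAbove a P.coeff)
    (hQ : VanishesAbove b Q.coeff) {k m : ℤ} {N : ℕ} (hm : m ≤ k - b) (hN : a + b < k + N) :
    compCoeff P Q k = ∑ i ∈ Finset.Icc m a, ∑ l ∈ Finset.range N, P.coeff i *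
      Ring.choose i l • shift (i - l) (diff^[l] (Q.coeff (k - i + l))) := by
  rw [compCoeff, finsum_eq_sum_of_support_subset (s := Finset.Icc m a ×ˢ Finset.range N),
    Finset.sum_product]
  rintro ⟨i, l⟩ hil
  by_contra h
  refine hil ?_
  dsimp only
  by_cases h1 : a < i
  · rw [hP _ h1, zero_mul]
  · have h2 : b < k - i + l := by
      rw [Finset.mem_coe, Finset.mem_product, Finset.mem_Icc, Finset.mem_range] at h
      dsimp only at h
      omega
    rw [hQ _ h2, diff_iterate_zero, map_zero, smul_zero, mul_zero]

theorem compCoeff_eq_act (P Q : PDO U 𝕂) : compCoeff P Q = P.act Q.coeff := by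
  obtain ⟨a, ha⟩ := P.bdd
  obtain ⟨b, hb⟩ := Q.bdd
  funext k
  obtain ⟨N, hN⟩ : ∃ N : ℕ, a + b < k + N := ⟨(a + b - k + 1).toNat, by omega⟩
  rw [compCoeff_eq_sum ha hb le_rfl hN, act_eq_sum ha hb le_rfl]
  refine Finset.sum_congr rfl fun i hi => ?_
  have := Finset.mem_Icc.1 hi
  rw [powDiff_eq_sum hb (N := N) (by omega), Finset.mul_sum]

theorem coeff_mul (P Q : PDO U 𝕂) : (P * Q).coeff = P.act Q.coeff := compCoeff_eq_act P Q

/-- Each $\Delta^i(q_j\Delta^jF)$ is expanded by the Leibniz rule and the powers of $\Delta$ are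
merged; both sides become the same triple sum with $m=i-l+j$. -/
theorem act_act (P Q : PDO U 𝕂) {c : ℤ} {F : ℤ → Fn U 𝕂} (hF : VanishesAbove c F) :
    P.act (Q.act F) = (P * Q).act F := by
  obtain ⟨a, ha⟩ := P.bdd
  obtain ⟨b, hb⟩ := Q.bdd
  have hQF := act_vanishesAbove hb hF
  have hPQ : VanishesAbove (a + b) (P * Q).coeff := by
    rw [coeff_mul]
    exact act_vanishesAbove ha hb
  funext k
  obtain ⟨N, hN⟩ : ∃ N : ℕ, a + b + c < k + N := ⟨(a + b + c - k + 1).toNat, by omega⟩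
  have hL : ∀ i ∈ Finset.Icc (k - (b + c)) a, powDiff i (Q.act F) k =
      ∑ j ∈ Finset.Icc (k - a - c) b, ∑ l ∈ Finset.range N,
        (Ring.choose i l • shift (i - l) (diff^[l] (Q.coeff j))) * powDiff (i - l + j) F k := by
    intro i hi
    have hi' := Finset.mem_Icc.1 hi
    have hj : ∀ j ∈ Finset.Icc (k - a - c) b,
        VanishesAbove (b + c) (fun k' => Q.coeff j * powDiff j F k') := by
      intro j hj k' hk'
      have := Finset.mem_Icc.1 hj
      dsimp only
      rw [powDiff_vanishesAbove hF j k' (by omega), mul_zero]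
    have h1 : powDiff i (Q.act F) k =
        ∑ j ∈ Finset.Icc (k - a - c) b, powDiff i (fun k' => Q.coeff j * powDiff j F k') k := by
      rw [powDiff_eq_sum hQF (N := N) (by omega), Finset.sum_congr rfl fun j hj' =>
        powDiff_eq_sum (hj j hj') (i := i) (k := k) (N := N) (by omega), Finset.sum_comm]
      refine Finset.sum_congr rfl fun l _ => ?_
      rw [act_eq_sum hb hF (m := k - a - c) (by omega), diff_iterate_sum, map_sum,
        Finset.smul_sum]
    rw [h1]
    refine Finset.sum_congr rfl fun j hj' => ?_
    have := Finset.mem_Icc.1 hj'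
    rw [powDiff_mul_left (powDiff_vanishesAbove hF j),
      leibnizSum_eq_sum (powDiff_vanishesAbove hF j) (N := N) _ (by omega)]
    exact Finset.sum_congr rfl fun l _ => by rw [powDiff_powDiff hF]
  have hR : ∀ m ∈ Finset.Icc (k - c) (a + b), (P * Q).coeff m * powDiff m F k =
      ∑ i ∈ Finset.Icc (k - (b + c)) a, ∑ l ∈ Finset.range N, P.coeff i *
        ((Ring.choose i l • shift (i - l) (diff^[l] (Q.coeff (m - i + l)))) * powDiff m F k) := by
    intro m hm
    have := Finset.mem_Icc.1 hm
    change compCoeff P Q m * _ = _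
    rw [compCoeff_eq_sum ha hb (m := k - (b + c)) (N := N) (by omega) (by omega)]
    simp only [Finset.sum_mul, mul_assoc]
  rw [act_eq_sum ha hQF le_rfl, act_eq_sum hPQ hF le_rfl, Finset.sum_congr rfl hR,
    Finset.sum_comm]
  refine Finset.sum_congr rfl fun i hi => ?_
  have hi' := Finset.mem_Icc.1 hi
  rw [hL i hi, Finset.sum_comm, Finset.sum_comm (s := Finset.Icc (k - c) (a + b)),
    Finset.mul_sum]
  refine Finset.sum_congr rfl fun l _ => ?_
  rw [← Finset.mul_sum]
  congr 1
  -- The ranges for `j` and `m` do not correspond under the translation, but each contains the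
  -- support, so the sums are compared over all of $\mathbb Z$.
  let h : ℤ → Fn U 𝕂 := fun m =>
    (Ring.choose i l • shift (i - l) (diff^[l] (Q.coeff (m - i + l)))) * powDiff m F k
  have hsupp : ∀ m, h m ≠ 0 → k - c ≤ m ∧ m - i + l ≤ b := by
    intro m hm
    by_contra hcon
    rw [not_and_or, not_le, not_le] at hcon
    refine hm ?_
    rcases hcon with h1 | h1
    · simp only [h]
      rw [powDiff_vanishesAbove hF m k (by omega), mul_zero]
    · simp only [h]
      rw [hb _ h1, diff_iterate_zero, map_zero, smul_zero, zero_mul]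
  have h1 : ∑ᶠ m, h m = ∑ m ∈ Finset.Icc (k - c) (a + b), h m := by
    refine finsum_eq_sum_of_support_subset _ fun m hm => ?_
    have := hsupp m hm
    rw [Finset.mem_coe, Finset.mem_Icc]
    omega
  have h2 : ∑ᶠ j, h (i - l + j) = ∑ j ∈ Finset.Icc (k - a - c) b, h (i - l + j) := by
    refine finsum_eq_sum_of_support_subset _ fun j hj => ?_
    have := hsupp _ hj
    rw [Finset.mem_coe, Finset.mem_Icc]
    omega
  have h3 : ∑ᶠ j, h (i - l + j) = ∑ᶠ m, h m := finsum_comp_equiv (Equiv.addLeft (i - (l : ℤ)))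
  refine Eq.trans ?_ ((h2.symm.trans h3).trans h1)
  refine Finset.sum_congr rfl fun j _ => ?_
  simp only [h]
  rw [show i - (l : ℤ) + j - i + l = j by ring]

theorem mul_assoc' (P Q R : PDO U 𝕂) : P * Q * R = P * (Q * R) := by
  obtain ⟨c, hc⟩ := R.bdd
  ext1
  rw [coeff_mul, coeff_mul, coeff_mul, act_act P Q hc]

theorem coeff_mul_delta (P : PDO U 𝕂) (m k : ℤ) :
    (P * delta m).coeff k = P.coeff (k - m) := by
  have hd : ∀ l : ℕ, diff^[l + 1] (1 : Fn U 𝕂) = 0 := by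
    intro l
    have h1 : diff (1 : Fn U 𝕂) = 0 := by simp [diff]
    rw [Function.iterate_succ_apply, h1, diff_iterate_zero]
  have hp : ∀ i, powDiff i (delta m : PDO U 𝕂).coeff k = if k - i = m then 1 else 0 := by
    intro i
    rw [powDiff, finsum_eq_single _ 0]
    · simp only [delta, Ring.choose_zero_right, one_smul, Function.iterate_zero, id,
        Nat.cast_zero, add_zero]
      split_ifs <;> simp
    · intro l hl
      obtain ⟨l, rfl⟩ := Nat.exists_eq_succ_of_ne_zero hl
      simp only [delta]
      split_ifs
      · rw [Nat.succ_eq_add_one, hd, map_zero, smul_zero]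
      · rw [diff_iterate_zero, map_zero, smul_zero]
  rw [coeff_mul, act, finsum_eq_single _ (k - m)]
  · rw [hp, if_pos (by ring), mul_one]
  · intro i hi
    rw [hp, if_neg (by omega), mul_zero]

theorem one_mul' (P : PDO U 𝕂) : 1 * P = P := by
  ext1
  rw [coeff_mul]
  funext k
  rw [act, finsum_eq_single _ 0]
  · rw [powDiff_zero]
    exact one_mul _
  · intro i hi
    change (if i = 0 then 1 else 0) * _ = _
    rw [if_neg hi, zero_mul]

theorem laxOp_mul {Z Y : PDO U 𝕂} (h : Y * Z = 1) : laxOp Z Y * Z = Z * delta 1 := by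
  rw [laxOp, mul_assoc', h]
  ext1
  funext k
  exact (coeff_mul_delta _ 0 k).trans (by rw [sub_zero])

theorem coeff_npow_laxOp_mul {Z Y : PDO U 𝕂} (h : Y * Z = 1) (i : ℕ) (k : ℤ) :
    ((laxOp Z Y).npow i * Z).coeff k = Z.coeff (k - i) := by
  induction i generalizing k with
  | zero =>
    change (1 * Z).coeff k = _
    rw [one_mul', Nat.cast_zero, sub_zero]
  | succ i ih =>
    change ((laxOp Z Y).npow i * laxOp Z Y * Z).coeff k = _
    rw [mul_assoc', laxOp_mul h, ← mul_assoc', coeff_mul_delta, ih, Nat.cast_succ,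
      sub_sub, add_comm 1]

/-- The positive part of `P` acts by the finite sum `∑_{j ≥ 1} p_j Δ^j`. -/
theorem coeff_mul_eq_lowPart_add (P Q : PDO U 𝕂) {a : ℕ} (ha : VanishesAbove a P.coeff) (k : ℤ) :
    (P * Q).coeff k = (P.lowPart * Q).coeff k + ∑ j ∈ Finset.range a,
      P.coeff ((j + 1 : ℕ) : ℤ) * (symbolDiff U 𝕂 ^ (j + 1)) Q.coeff k := by
  obtain ⟨b, hb⟩ := Q.bdd
  have hl : VanishesAbove 0 P.lowPart.coeff := fun i hi => if_neg (not_le.2 hi)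
  obtain ⟨m, hm, hm0⟩ : ∃ m : ℤ, m ≤ k - b ∧ m ≤ 0 := ⟨min (k - b) 0, by omega, by omega⟩
  rw [coeff_mul, coeff_mul, act_eq_sum ha hb hm, act_eq_sum hl hb hm]
  have hsplit : Finset.Icc m (a : ℤ) = Finset.Icc m 0 ∪ (Finset.range a).map
      ⟨fun j : ℕ => ((j + 1 : ℕ) : ℤ), fun x y h => by simpa using h⟩ := by
    ext i
    simp only [Finset.mem_Icc, Finset.mem_union, Finset.mem_map, Finset.mem_range]
    constructor
    · intro h
      by_cases hi : i ≤ 0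
      · exact Or.inl ⟨h.1, hi⟩
      · exact Or.inr ⟨(i - 1).toNat, by omega, by
          change (((i - 1).toNat + 1 : ℕ) : ℤ) = i
          omega⟩
    · rintro (h | ⟨j, hj, rfl⟩)
      · omega
      · change m ≤ ((j + 1 : ℕ) : ℤ) ∧ ((j + 1 : ℕ) : ℤ) ≤ a
        omega
  have hdisj : Disjoint (Finset.Icc m 0) ((Finset.range a).map
      ⟨fun j : ℕ => ((j + 1 : ℕ) : ℤ), fun x y h => by simpa using h⟩) := by
    rw [Finset.disjoint_left]
    intro i hi hi'
    have h1 := Finset.mem_Icc.1 hi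
    obtain ⟨j, _, rfl⟩ := Finset.mem_map.1 hi'
    change m ≤ ((j + 1 : ℕ) : ℤ) ∧ ((j + 1 : ℕ) : ℤ) ≤ 0 at h1
    omega
  rw [hsplit, Finset.sum_union hdisj, Finset.sum_map]
  congr 1
  · refine Finset.sum_congr rfl fun i hi => ?_
    change _ = (if i ≤ 0 then P.coeff i else 0) * _
    rw [if_pos (Finset.mem_Icc.1 hi).2]
  · refine Finset.sum_congr rfl fun j _ => ?_
    rw [← powDiff_natCast hb]
    rfl

theorem Smooth.mul (hU : IsTimeDomain U) {P Q : PDO U 𝕂} (hP : P.Smooth) (hQ : Q.Smooth) :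
    (P * Q).Smooth := by
  intro k
  change compCoeff P Q k ∈ smoothFn hU 𝕂
  have hd : ∀ (l : ℕ) f, f ∈ smoothFn hU 𝕂 → diff^[l] f ∈ smoothFn hU 𝕂 := by
    intro l f hf
    induction l with
    | zero => exact hf
    | succ l ih =>
      rw [Function.iterate_succ_apply']
      exact sub_mem (IsSmooth.shift ih 1) ih
  refine finsum_induction (· ∈ smoothFn hU 𝕂) (zero_mem _) (fun _ _ => add_mem) fun p => ?_
  exact mul_mem (hP p.1) (zsmul_mem (IsSmooth.shift (hd _ _ (hQ _)) _) _)

theorem smooth_delta (hU : IsTimeDomain U) (m : ℤ) : (delta m : PDO U 𝕂).Smooth := by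
  intro k
  change (if k = m then 1 else 0) ∈ smoothFn hU 𝕂
  split_ifs
  · exact one_mem _
  · exact zero_mem _

theorem Smooth.npow (hU : IsTimeDomain U) {P : PDO U 𝕂} (hP : P.Smooth) (i : ℕ) :
    (P.npow i).Smooth := by
  induction i with
  | zero => exact smooth_delta hU 0
  | succ i ih => exact ih.mul hU hP

end PDO

end Assoc
/-! ### The difference Fay identity -/

section Fay

variable {U : Set Times} {𝕂 : Type*} [RCLike 𝕂]

theorem isSmooth_inv {f : Fn U 𝕂} (hf : IsSmooth f) (h : ∀ n t, f n t ≠ 0) : IsSmooth f⁻¹ := by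
  intro n t S
  have h1 : ∀ t', zeroExt (f⁻¹ n) t' = (zeroExt (f n) t')⁻¹ := by
    intro t'
    by_cases ht : t' ∈ U
    · simp only [zeroExt_mk _ ht, Pi.inv_apply]
    · simp only [zeroExt_of_notMem _ ht, inv_zero]
  simp only [h1]
  refine (hf n t S).inv ?_
  rw [move_zero, zeroExt_coe]
  exact h n t

theorem isUnit_smoothFn (hU : IsTimeDomain U) {f : Fn U 𝕂} (hf : IsSmooth f)
    (h : ∀ n t, f n t ≠ 0) : IsUnit (⟨f, hf⟩ : smoothFn hU 𝕂) := by
  refine IsUnit.of_mul_eq_one ⟨f⁻¹, isSmooth_inv hf h⟩ (Subtype.ext ?_)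
  funext n t
  exact mul_inv_cancel₀ (h n t)

theorem toLaurent_eq_sInv_mul {F G : PowerSeries (Fn U 𝕂)} (h : PowerSeries.X * F = G) :
    toLaurent F = sInv * toLaurent G := by
  rw [← h, toLaurent, toLaurent, map_mul, HahnSeries.ofPowerSeries_X, sInv, ← mul_assoc,
    HahnSeries.single_mul_single, neg_add_cancel, mul_one]
  exact (one_mul _).symm

/-- The coefficients of a dressing operator, as elements of the algebra of smooth functions. -/
def smoothCoeff (hU : IsTimeDomain U) {Z : PDO U 𝕂} (hZ : Z.Smooth) (k : ℤ) : smoothFn hU 𝕂 :=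
  ⟨Z.coeff k, hZ k⟩

theorem coe_hatDiff_pow (hU : IsTimeDomain U) (j : ℕ) (F : ℤ → smoothFn hU 𝕂) (k : ℤ) :
    (((hatDiff (smoothShift hU 𝕂 : smoothFn hU 𝕂 →+* smoothFn hU 𝕂) ^ j) F k : smoothFn hU 𝕂) :
      Fn U 𝕂) = (symbolDiff U 𝕂 ^ j) (fun k => (F k : Fn U 𝕂)) k :=
  hatDiff_pow_comp (A := smoothFn hU 𝕂) (B := Fn U 𝕂) _ (shift 1)
    ((smoothFn hU 𝕂).val : smoothFn hU 𝕂 →+* Fn U 𝕂).toAddMonoidHom (fun _ => rfl) j F k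

/-- The linear problem `∂ᵢ w = ∑_{j ≥ 1} bᵢⱼ Δ^j w` for the wave function. -/
theorem exists_linear_problem (hU : IsTimeDomain U) {Z Y : PDO U 𝕂} (hZ : IsDressing Z Y) :
    ∃ (J : ℕ → ℕ) (b : ℕ → ℕ → smoothFn hU 𝕂), ∀ (i : ℕ) (k : ℤ),
      smoothDeriv hU 𝕂 i (smoothCoeff hU hZ.smooth k) +
          smoothCoeff hU hZ.smooth (k - (i + 1)) =
        ∑ j ∈ Finset.range (J i), b i j * (hatDiff (smoothShift hU 𝕂 :
          smoothFn hU 𝕂 →+* smoothFn hU 𝕂) ^ (j + 1)) (smoothCoeff hU hZ.smooth) k := by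
  have hL : (laxOp Z Y).Smooth :=
    PDO.Smooth.mul hU (PDO.Smooth.mul hU hZ.smooth (PDO.smooth_delta hU 1)) hZ.smooth_inv
  have hJ : ∀ i : ℕ, ∃ a : ℕ, VanishesAbove a ((laxOp Z Y).npow (i + 1)).coeff := by
    intro i
    obtain ⟨m, hm⟩ := ((laxOp Z Y).npow (i + 1)).bdd
    exact ⟨m.toNat, fun k hk => hm k (by omega)⟩
  choose J hJ using hJ
  refine ⟨J, fun i j => ⟨((laxOp Z Y).npow (i + 1)).coeff ((j + 1 : ℕ) : ℤ),
    PDO.Smooth.npow hU hL (i + 1) _⟩, fun i k => Subtype.ext ?_⟩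
  -- Splits $Z\Delta^{i+1}=L^{i+1}Z$ by order; the Sato equation then cancels the part of order at
  -- most 0.
  have h1 := PDO.coeff_mul_eq_lowPart_add ((laxOp Z Y).npow (i + 1)) Z (hJ i) k
  rw [PDO.coeff_npow_laxOp_mul hZ.inv_mul, Nat.cast_succ] at h1
  have h2 := hZ.sato i.succPNat k
  rw [Nat.succPNat_coe, Nat.succ_eq_add_one] at h2
  change pderiv i.succPNat (Z.coeff k) + Z.coeff (k - (i + 1)) = _
  rw [h2, h1, neg_add_cancel_left, AddSubmonoidClass.coe_finsetSum]
  refine Finset.sum_congr rfl fun j _ => ?_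
  rw [MulMemClass.coe_mul, coe_hatDiff_pow]
  rfl

/-- The difference Fay identity without denominators. -/
theorem flow_fay (hU : IsTimeDomain U) {Z Y : PDO U 𝕂} (hZ : IsDressing Z Y)
    {τ₀ τ₁ : Fn U 𝕂} (hτ : IsTauPair Z Y τ₀ τ₁) (T₀ T₁ : smoothFn hU 𝕂) (h₀ : T₀.1 = τ₀)
    (h₁ : T₁.1 = τ₁) :
    PowerSeries.C (smoothShift hU 𝕂 T₀) * flow (smoothDeriv hU 𝕂) (-1) T₁ =
      (1 + PowerSeries.X) * (PowerSeries.C T₁ *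
          flow (smoothDeriv hU 𝕂) (-1) (smoothShift hU 𝕂 T₀)) -
        PowerSeries.X * (PowerSeries.C (smoothShift hU 𝕂 T₁) *
          flow (smoothDeriv hU 𝕂) (-1) T₀) := by
  subst h₀ h₁
  obtain ⟨J, b, hb⟩ := exists_linear_problem hU hZ
  have hu₀ : IsUnit T₀ := isUnit_smoothFn hU T₀.2 hτ.ne_zero₀
  set F := smoothCoeff hU hZ.smooth
  set D := smoothDeriv hU 𝕂
  set σ := smoothShift hU 𝕂
  have hW : PowerSeries.mk (fun r => F (-r)) * PowerSeries.C T₁ = flow D (-1) T₀ := by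
    refine PowerSeries.ext fun r => ?_
    rw [PowerSeries.coeff_mul_C, PowerSeries.coeff_mk]
    refine Subtype.ext ?_
    have h := hτ.wave_eq (-r)
    rw [wave, coeffLambda, if_pos (by omega), neg_neg, Int.toNat_natCast,
      PowerSeries.coeff_mul_C, miwa_eq_map_flow hU, PowerSeries.coeff_map] at h
    change Z.coeff (-r) * T₁.1 = _
    rw [h]
    funext n t
    exact inv_mul_cancel_right₀ (hτ.ne_zero₁ n t) _
  have h00 : F 0 * T₁ = T₀ := by
    have h := congrArg (PowerSeries.coeff 0) hW
    rwa [PowerSeries.coeff_mul_C, PowerSeries.coeff_mk, coeff_zero_flow, Nat.cast_zero,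
      neg_zero] at h
  have hreg : ∀ j, IsUnit (σ^[j] (F 0)) := by
    intro j
    induction j with
    | zero => exact isUnit_of_mul_isUnit_left (h00 ▸ hu₀)
    | succ j ih =>
      rw [Function.iterate_succ_apply']
      exact ih.map σ
  have hdr := flow_dressing (σ := σ) (smoothDeriv_smoothShift hU) hb
    (fun k hk => Subtype.ext (hZ.order k hk)) fun j => (hreg j).isRegular
  have hσW : PowerSeries.mk (fun r => σ (F (-r))) * PowerSeries.C (σ T₁) =
      flow D (-1) (σ T₀) := by
    rw [← map_flow D (-1) σ (smoothDeriv_smoothShift hU), ← hW, map_mul, PowerSeries.map_C]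
    rfl
  have hM : flow D (-1) (F 0) * flow D (-1) T₁ = flow D (-1) T₀ := by rw [← flow_mul, h00]
  have hC : PowerSeries.C (σ (F 0)) * PowerSeries.C (σ T₁) = PowerSeries.C (σ T₀) := by
    rw [← map_mul, ← map_mul, h00]
  have hu : IsUnit (flow D (-1) T₀) := hu₀.map (flowHom D (-1))
  -- `hdr` contains $z_0(t-[s])$, which becomes $\tau_0(t-[s])$ on multiplication by
  -- $\tau_1(t-[s])$; the resulting common factor $\tau_0(t-[s])$ is a unit.
  refine hu.mul_right_cancel ?_
  linear_combination -(flow D (-1) T₁ * flow D (-1) T₀) * hC -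
    (flow D (-1) T₁ * PowerSeries.C (σ (F 0)) * PowerSeries.C (σ T₁) +
      PowerSeries.X * PowerSeries.C (σ T₁) * flow D (-1) T₀) * hW +
    PowerSeries.C (σ T₁) * flow D (-1) T₁ * PowerSeries.C T₁ * hdr +
    PowerSeries.C (σ T₁) * PowerSeries.C T₁ *
      ((1 + PowerSeries.X) * PowerSeries.mk (fun r => σ (F (-r))) -
        PowerSeries.X * PowerSeries.mk (fun r => F (-r))) * hM +
    PowerSeries.C T₁ * (1 + PowerSeries.X) * flow D (-1) T₀ * hσW

/-- The substitution $t\mapsto t+[s]$ exchanges shifted and unshifted factors in every product. -/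
theorem flow_fay_adjoint (hU : IsTimeDomain U) {T₀ T₁ : smoothFn hU 𝕂}
    (h : PowerSeries.C (smoothShift hU 𝕂 T₀) * flow (smoothDeriv hU 𝕂) (-1) T₁ =
      (1 + PowerSeries.X) * (PowerSeries.C T₁ *
          flow (smoothDeriv hU 𝕂) (-1) (smoothShift hU 𝕂 T₀)) -
        PowerSeries.X * (PowerSeries.C (smoothShift hU 𝕂 T₁) *
          flow (smoothDeriv hU 𝕂) (-1) T₀)) :
    flow (smoothDeriv hU 𝕂) 1 (smoothShift hU 𝕂 T₀) * PowerSeries.C T₁ +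
        PowerSeries.X * (flow (smoothDeriv hU 𝕂) 1 (smoothShift hU 𝕂 T₁) * PowerSeries.C T₀) =
      (1 + PowerSeries.X) *
        (flow (smoothDeriv hU 𝕂) 1 T₁ * PowerSeries.C (smoothShift hU 𝕂 T₀)) := by
  have h1 : PowerSeries.C (smoothShift hU 𝕂 T₀) * flow (smoothDeriv hU 𝕂) (-1) T₁ +
      PowerSeries.X * (PowerSeries.C (smoothShift hU 𝕂 T₁) * flow (smoothDeriv hU 𝕂) (-1) T₀) =
      PowerSeries.C T₁ * flow (smoothDeriv hU 𝕂) (-1) (smoothShift hU 𝕂 T₀) +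
        PowerSeries.X *
          (PowerSeries.C T₁ * flow (smoothDeriv hU 𝕂) (-1) (smoothShift hU 𝕂 T₀)) := by
    linear_combination h
  have h2 := congrArg (flowSeries (smoothDeriv hU 𝕂) 1) h1
  simp only [flowSeries_add, flowSeries_X_mul, flowSeries_C_mul,
    flowSeries_flow (smoothDeriv hU 𝕂) 1 (smoothDeriv_comm hU)] at h2
  linear_combination h2

end Fay
end DmKP

theorem proposition3p1 {𝕂 : Type*} [RCLike 𝕂] (U : Set DmKP.Times) (hU : DmKP.IsTimeDomain U)
    (Z Y : DmKP.PDO U 𝕂) (hZ : DmKP.IsDressing Z Y)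
    (τ₀ τ₁ : DmKP.Fn U 𝕂) (hτ : DmKP.IsTauPair Z Y τ₀ τ₁) :
    DmKP.toLaurent (DmKP.diffSeries (DmKP.miwa (-1) τ₀ * PowerSeries.C τ₁⁻¹)) =
        DmKP.sInv * DmKP.toLaurent
          (PowerSeries.C (DmKP.shift 1 τ₀ / (τ₁ * DmKP.shift 1 τ₁)) * DmKP.miwa (-1) τ₁
            - DmKP.miwa (-1) (DmKP.shift 1 τ₀) * PowerSeries.C (DmKP.shift 1 τ₁)⁻¹) ∧
    DmKP.toLaurent (DmKP.diffSeries (DmKP.miwa 1 τ₁ * PowerSeries.C τ₀⁻¹)) =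
        DmKP.sInv * DmKP.toLaurent
          (DmKP.miwa 1 τ₁ * PowerSeries.C τ₀⁻¹
            - PowerSeries.C (τ₁ / (τ₀ * DmKP.shift 1 τ₀)) * DmKP.miwa 1 (DmKP.shift 1 τ₀)) := by
  have H := DmKP.flow_fay hU hZ hτ ⟨τ₀, hτ.smooth₀⟩ ⟨τ₁, hτ.smooth₁⟩ rfl rfl
  have H' := DmKP.flow_fay_adjoint hU H
  have hinv : ∀ f : DmKP.Fn U 𝕂, (∀ n t, f n t ≠ 0) →
      PowerSeries.C f * PowerSeries.C f⁻¹ = 1 := by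
    intro f hf
    rw [← map_mul, ← map_one PowerSeries.C]
    congr 1
    funext n t
    exact mul_inv_cancel₀ (hf n t)
  have h0 := hinv τ₀ hτ.ne_zero₀
  have h1 := hinv τ₁ hτ.ne_zero₁
  have h0' := hinv (DmKP.shift 1 τ₀) fun n t => hτ.ne_zero₀ (n + 1) t
  have h1' := hinv (DmKP.shift 1 τ₁) fun n t => hτ.ne_zero₁ (n + 1) t
  have hshift : ∀ (ε : ℝ) (f : DmKP.Fn U 𝕂), PowerSeries.map (DmKP.shift 1) (DmKP.miwa ε f) =
      DmKP.miwa ε (DmKP.shift 1 f) := fun ε f => rfl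
  have hinvshift : ∀ f : DmKP.Fn U 𝕂, DmKP.shift 1 f⁻¹ = (DmKP.shift 1 f)⁻¹ := fun f => rfl
  have hdiv : ∀ a b c : DmKP.Fn U 𝕂, PowerSeries.C (a / (b * c)) =
      PowerSeries.C a * PowerSeries.C b⁻¹ * PowerSeries.C c⁻¹ := by
    intro a b c
    rw [div_eq_mul_inv, mul_inv, map_mul, map_mul, mul_assoc]
  -- Both relations are carried from smooth functions to all functions, where the formal flow is
  -- `miwa`; division by the tau functions then finishes.
  have K := congrArg (PowerSeries.map (DmKP.smoothFn hU 𝕂).val.toRingHom) H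
  have K' := congrArg (PowerSeries.map (DmKP.smoothFn hU 𝕂).val.toRingHom) H'
  simp only [map_add, map_sub, map_mul, map_one, PowerSeries.map_X, PowerSeries.map_C,
    ← DmKP.miwa_eq_map_flow] at K K'
  change PowerSeries.C (DmKP.shift 1 τ₀) * DmKP.miwa (-1) τ₁ =
    (1 + PowerSeries.X) * (PowerSeries.C τ₁ * DmKP.miwa (-1) (DmKP.shift 1 τ₀)) -
      PowerSeries.X * (PowerSeries.C (DmKP.shift 1 τ₁) * DmKP.miwa (-1) τ₀) at K
  change DmKP.miwa 1 (DmKP.shift 1 τ₀) * PowerSeries.C τ₁ +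
      PowerSeries.X * (DmKP.miwa 1 (DmKP.shift 1 τ₁) * PowerSeries.C τ₀) =
    (1 + PowerSeries.X) * (DmKP.miwa 1 τ₁ * PowerSeries.C (DmKP.shift 1 τ₀)) at K'
  constructor
  · refine DmKP.toLaurent_eq_sInv_mul ?_
    rw [DmKP.diffSeries, map_mul, PowerSeries.map_C, hshift, hinvshift, hdiv]
    linear_combination -(PowerSeries.C τ₁⁻¹ * PowerSeries.C (DmKP.shift 1 τ₁)⁻¹) * K -
      (1 + PowerSeries.X) * DmKP.miwa (-1) (DmKP.shift 1 τ₀) *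
        PowerSeries.C (DmKP.shift 1 τ₁)⁻¹ * h1 +
      PowerSeries.X * DmKP.miwa (-1) τ₀ * PowerSeries.C τ₁⁻¹ * h1'
  · refine DmKP.toLaurent_eq_sInv_mul ?_
    rw [DmKP.diffSeries, map_mul, PowerSeries.map_C, hshift, hinvshift, hdiv]
    linear_combination (PowerSeries.C τ₀⁻¹ * PowerSeries.C (DmKP.shift 1 τ₀)⁻¹) * K' -
      PowerSeries.X * DmKP.miwa 1 (DmKP.shift 1 τ₁) *
        PowerSeries.C (DmKP.shift 1 τ₀)⁻¹ * h0 +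
      (1 + PowerSeries.X) * DmKP.miwa 1 τ₁ * PowerSeries.C τ₀⁻¹ * h0'
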